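/- Let $\mathcal A$ be the qubit spin chain, i.e. the quasi-local $C^*$-algebra on $\mathbb Z$ with on-site algebras $\mathcal A_j\simeq \mathrm{End}(\mathbb C^2)$, $j\in\mathbb Z$, and local subalgebras $\mathcal A_X$, $X\subset\mathbb Z$. A quantum cellular automaton (QCA) is a $*$-automorphism $\alpha$ of $\mathcal A$ for which there is $r\ge 0$ such that $\alpha(\mathcal A_X)\subset\mathcal A_{X^{(r)}}$ for all $X\subset\mathbb Z$, where $X^{(r)}$ is the set of sites at distance at most $r$ from $X$. It is block partitioned if it has the form $\bigotimes_a \mathrm{Ad}(U_a)$ for unitaries $U_a\in\mathcal A_{I_a}$ and a partition $\{I_a\}$ of $\mathbb Z$ into intervals of bounded size; a finite depth quantum circuit (FDQC) is a finite composition of block partitioned QCAs. For a finite group $G$, a $G$-symmetry is a homomorphism $\alpha$ from $G$ to the group of QCAs on $\mathcal A$, $g\mapsto\alpha^{(g)}$. It is decoupled if all $\alpha^{(g)}$ are block partitioned with respect to one common partition. The anomaly of a $G$-symmetry $\alpha$ is the class in $H^3(G,U(1))$ (trivial action on $U(1)$) obtained as follows. Choose a site $j$, some $L\ge0$ and a right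 restriction, i.e. automorphisms $\alpha^{(g)}_{\ge j}$ of $\mathcal A$ which agree with $\alpha^{(g)}$ on $\mathcal A_{[j+L,\infty)}$ and with the identity on $\mathcal A_{(-\infty,j-L-1]}$; choose local unitaries $F(g,h)$ with $\alpha_{\ge j}^{(g)}\circ\alpha_{\ge j}^{(h)}=\mathrm{Ad}[F(g,h)]\circ\alpha_{\ge j}^{(gh)}$; and take the class of the 3-cocycle $\omega:G^3\to U(1)$ determined by $$F(f,g)F(fg,h)=\omega(f,g,h)\,\alpha_{\ge j}^{(f)}(F(g,h))\,F(f,gh).$$ The anomaly of $\alpha$ is trivial if such choices exist and every such choice gives the identity element of $H^3(G,U(1))$. Let $Z_j$ be the Pauli matrix $\mathrm{diag}(1,-1)$ at site $j$, $P_j^{\downarrow}=(1-Z_j)/2$, $CZ_{j,j+1}=1-2P_j^{\downarrow}P_{j+1}^{\downarrow}$, and $U_{[a,b]}=\prod_{j=a}^{b-1}CZ_{j,j+1}$. **Theorem.** There is a $\mathbb Z_2=\{1,-1\}$-symmetry $\alpha$ on $\mathcal A$ with $\alpha^{(-1)}(x)=\lim_{n\to\infty}U_{[-n,n]}\,x\,U_{[-n,n]}^*$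 in norm for every $x\in\mathcal A$. It has trivial anomaly, but it is not equivalent (without stacking with ancillas) to a decoupled symmetry: there are no FDQC $\gamma$ on $\mathcal A$ and no decoupled $\mathbb Z_2$-symmetry $\beta$ on $\mathcal A$ such that $\beta^{(g)}=\gamma^{-1}\circ\alpha^{(g)}\circ\gamma$ for all $g\in\mathbb Z_2$. -/

import Mathlib

open scoped ENNReal

noncomputable section

namespace SpinChain

/-! ## The quasi-local algebra of the qubit chain -/

/-- Classical configurations `ℤ → {0, 1}` of the chain. -/
abbrev Config : Type := ℤ → Fin 2

/-- A Hilbert space with an orthonormal basis labelled by all configurations. All local operators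
act faithfully on it. -/
abbrev Hilb : Type := lp (fun _ : Config => ℂ) 2

/-- The function underlying `M_j f`, where the `2 × 2` matrix `M` acts on the tensor factor at
site `j`: on basis vectors, `M_j e_τ = ∑ a, M a (τ j) • e_{τ[j := a]}`. -/
def siteFun (j : ℤ) (M : Matrix (Fin 2) (Fin 2) ℂ) (f : Config → ℂ) : Config → ℂ :=
  fun σ => ∑ b : Fin 2, M (σ j) b * f (Function.update σ j b)

/-- The involution `(σ, b) ↦ (σ[j := b], σ j)`. -/
def swapAt (j : ℤ) : Config × Fin 2 ≃ Config × Fin 2 where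
  toFun p := (Function.update p.1 j p.2, p.1 j)
  invFun p := (Function.update p.1 j p.2, p.1 j)
  left_inv p := by simp
  right_inv p := by simp

theorem hasSum_normSq (f : Hilb) : HasSum (fun σ => ‖f σ‖ ^ 2) (‖f‖ ^ 2) := by
  have h := lp.hasSum_norm (p := 2) (by norm_num) f
  simpa using h

theorem hasSum_normSq_prod (f : Hilb) :
    HasSum (fun p : Config × Fin 2 => ‖f p.1‖ ^ 2) (2 * ‖f‖ ^ 2) := by
  have hs : Summable (fun p : Fin 2 × Config => ‖f p.2‖ ^ 2) := by
    rw [summable_prod_of_nonneg (fun _ => by positivity)]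
    exact ⟨fun _ => (hasSum_normSq f).summable, Summable.of_finite⟩
  have h2 := (hs.hasSum.prod_fiberwise (fun _ => hasSum_normSq f)).unique (hasSum_fintype _)
  simp only [Finset.sum_const, Finset.card_univ, Fintype.card_fin, nsmul_eq_mul] at h2
  rw [← (by exact_mod_cast h2 : _ = 2 * ‖f‖ ^ 2)]
  exact (Equiv.prodComm Config (Fin 2)).hasSum_iff.mpr hs.hasSum

theorem hasSum_normSq_update (j : ℤ) (f : Hilb) :
    HasSum (fun p : Config × Fin 2 => ‖f (Function.update p.1 j p.2)‖ ^ 2) (2 * ‖f‖ ^ 2) :=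
  (swapAt j).hasSum_iff.mpr (hasSum_normSq_prod f)

theorem hasSum_update (j : ℤ) (f : Hilb) :
    HasSum (fun σ => ∑ b : Fin 2, ‖f (Function.update σ j b)‖ ^ 2) (2 * ‖f‖ ^ 2) :=
  (hasSum_normSq_update j f).prod_fiberwise (fun _ => hasSum_fintype _)

theorem norm_entry_le (M : Matrix (Fin 2) (Fin 2) ℂ) (a b : Fin 2) :
    ‖M a b‖ ≤ ∑ a, ∑ b, ‖M a b‖ :=
  (Finset.single_le_sum (f := fun b => ‖M a b‖) (fun _ _ => norm_nonneg _)
    (Finset.mem_univ b)).trans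
  (Finset.single_le_sum (f := fun a => ∑ b, ‖M a b‖)
    (fun _ _ => Finset.sum_nonneg fun _ _ => norm_nonneg _) (Finset.mem_univ a))

theorem siteFun_bound (j : ℤ) (M : Matrix (Fin 2) (Fin 2) ℂ) (f : Config → ℂ) (σ : Config) :
    ‖siteFun j M f σ‖ ^ 2 ≤
      (2 * (∑ a, ∑ b, ‖M a b‖) ^ 2) * ∑ b : Fin 2, ‖f (Function.update σ j b)‖ ^ 2 := by
  set C := ∑ a, ∑ b, ‖M a b‖ with hC
  have h1 : ‖siteFun j M f σ‖ ≤ C * ∑ b : Fin 2, ‖f (Function.update σ j b)‖ := by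
    refine (norm_sum_le _ _).trans ?_
    rw [Finset.mul_sum]
    refine Finset.sum_le_sum fun b _ => ?_
    rw [norm_mul]
    exact mul_le_mul_of_nonneg_right (norm_entry_le M _ _) (norm_nonneg _)
  have h2 : (∑ b : Fin 2, ‖f (Function.update σ j b)‖) ^ 2 ≤
      2 * ∑ b : Fin 2, ‖f (Function.update σ j b)‖ ^ 2 := by
    have := sq_sum_le_card_mul_sum_sq (s := (Finset.univ : Finset (Fin 2)))
      (f := fun b => ‖f (Function.update σ j b)‖)
    simpa using this
  calc ‖siteFun j M f σ‖ ^ 2 ≤ (C * ∑ b : Fin 2, ‖f (Function.update σ j b)‖) ^ 2 := by gcongr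
    _ = C ^ 2 * (∑ b : Fin 2, ‖f (Function.update σ j b)‖) ^ 2 := by ring
    _ ≤ C ^ 2 * (2 * ∑ b : Fin 2, ‖f (Function.update σ j b)‖ ^ 2) := by gcongr
    _ = _ := by ring

theorem memℓp_siteFun (j : ℤ) (M : Matrix (Fin 2) (Fin 2) ℂ) (f : Hilb) :
    Memℓp (siteFun j M f) 2 := by
  apply memℓp_gen
  simp only [ENNReal.toReal_ofNat, Real.rpow_ofNat]
  exact Summable.of_nonneg_of_le (fun _ => by positivity) (siteFun_bound j M f)
    ((hasSum_update j f).summable.mul_left _)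

/-- The bounded operator `M_j` on `Hilb`. -/
def siteCLM (j : ℤ) (M : Matrix (Fin 2) (Fin 2) ℂ) : Hilb →L[ℂ] Hilb :=
  LinearMap.mkContinuous
    { toFun := fun f => ⟨siteFun j M f, memℓp_siteFun j M f⟩
      map_add' := fun f g => by
        ext σ
        change siteFun j M (fun τ => f τ + g τ) σ = siteFun j M f σ + siteFun j M g σ
        simp only [siteFun, mul_add, Finset.sum_add_distrib]
      map_smul' := fun c f => by
        ext σ
        change siteFun j M (fun τ => c * f τ) σ = c * siteFun j M f σ
        simp only [siteFun, Finset.mul_sum]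
        exact Finset.sum_congr rfl fun _ _ => by ring }
    (2 * ∑ a, ∑ b, ‖M a b‖) fun f => by
      have hC : 0 ≤ ∑ a, ∑ b, ‖M a b‖ :=
        Finset.sum_nonneg fun _ _ => Finset.sum_nonneg fun _ _ => norm_nonneg _
      refine le_of_sq_le_sq ?_ (by positivity)
      refine (hasSum_le (siteFun_bound j M f)
        (hasSum_normSq ⟨siteFun j M f, memℓp_siteFun j M f⟩)
        ((hasSum_update j f).mul_left _)).trans (le_of_eq ?_)
      ring

theorem siteCLM_apply (j : ℤ) (M : Matrix (Fin 2) (Fin 2) ℂ) (f : Hilb) (σ : Config) :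
    siteCLM j M f σ = ∑ b : Fin 2, M (σ j) b * f (Function.update σ j b) := rfl

theorem siteCLM_star (j : ℤ) (M : Matrix (Fin 2) (Fin 2) ℂ) :
    siteCLM j (star M) = star (siteCLM j M) := by
  rw [ContinuousLinearMap.star_eq_adjoint, ContinuousLinearMap.eq_adjoint_iff]
  intro f g
  set Φ : Config × Fin 2 → ℂ :=
    fun p => M (p.1 j) p.2 * g (Function.update p.1 j p.2) * star (f p.1) with hΦ
  have hs : Summable Φ := by
    refine Summable.of_norm_bounded (((hasSum_normSq_update j g).summable.add
      (hasSum_normSq_prod f).summable).mul_left (∑ a, ∑ b, ‖M a b‖)) fun p => ?_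
    rw [hΦ]
    simp only [norm_mul, norm_star, mul_assoc]
    refine mul_le_mul (norm_entry_le M _ _) ?_ (by positivity)
      ((norm_nonneg _).trans (norm_entry_le M 0 0))
    nlinarith [sq_nonneg (‖g (Function.update p.1 j p.2)‖ - ‖f p.1‖),
      sq_nonneg ‖g (Function.update p.1 j p.2)‖, sq_nonneg ‖f p.1‖]
  have hs' : Summable (Φ ∘ swapAt j) := (swapAt j).summable_iff.mpr hs
  rw [lp.inner_eq_tsum, lp.inner_eq_tsum]
  calc (∑' σ, inner ℂ (siteCLM j (star M) f σ) (g σ))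
      = ∑' σ, ∑ b, (Φ ∘ swapAt j) (σ, b) := by
        refine tsum_congr fun σ => ?_
        simp [siteCLM_apply, hΦ, swapAt, Matrix.star_apply]
        ring
    _ = ∑' p, (Φ ∘ swapAt j) p :=
        (hs'.hasSum.prod_fiberwise fun _ => hasSum_fintype _).tsum_eq
    _ = ∑' p, Φ p := (swapAt j).tsum_eq Φ
    _ = ∑' σ, ∑ b, Φ (σ, b) := (hs.hasSum.prod_fiberwise fun _ => hasSum_fintype _).tsum_eq.symm
    _ = ∑' σ, inner ℂ (f σ) (siteCLM j M g σ) := by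
        refine tsum_congr fun σ => ?_
        simp [siteCLM_apply, hΦ]
        ring

/-- The action of the on-site algebra at site `j`, by bounded operators on `Hilb`. -/
def siteRep (j : ℤ) : Matrix (Fin 2) (Fin 2) ℂ →⋆ₐ[ℂ] (Hilb →L[ℂ] Hilb) where
  toFun := siteCLM j
  map_one' := by
    ext f σ
    simp [siteCLM_apply, Matrix.one_apply]
  map_mul' M N := by
    ext f σ
    simp [siteCLM_apply, Matrix.mul_apply]
    ring
  map_zero' := by
    ext f σ
    simp [siteCLM_apply]
  map_add' M N := by
    ext f σ
    simp [siteCLM_apply, add_mul]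
    ring
  commutes' c := by
    ext f σ
    simp [siteCLM_apply, Algebra.algebraMap_eq_smul_one, Matrix.one_apply]
  map_star' := siteCLM_star j

/-- The quasi-local algebra of the qubit chain: the norm closure of the `*`-algebra generated by
all on-site algebras `End(ℂ²)`, acting on different tensor factors. -/
def quasiLocal : StarSubalgebra ℂ (Hilb →L[ℂ] Hilb) :=
  (StarAlgebra.adjoin ℂ (⋃ j : ℤ, Set.range (siteRep j))).topologicalClosure

/-- The spin chain `C*`-algebra `𝒜`. -/
abbrev Chain : Type := quasiLocal

theorem siteRep_mem (j : ℤ) (M : Matrix (Fin 2) (Fin 2) ℂ) : siteRep j M ∈ quasiLocal :=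
  StarSubalgebra.le_topologicalClosure _
    (StarAlgebra.subset_adjoin ℂ _ (Set.mem_iUnion.mpr ⟨j, M, rfl⟩))

/-- The embedding `End(ℂ²) → 𝒜` of the on-site algebra at site `j`. -/
def site (j : ℤ) : Matrix (Fin 2) (Fin 2) ℂ →⋆ₐ[ℂ] Chain :=
  (siteRep j).codRestrict quasiLocal (siteRep_mem j)

/-- The local subalgebra `𝒜_X` for a (finite or infinite) set of sites `X`: the norm-closed
unital `*`-subalgebra generated by the on-site algebras at the sites of `X`. -/
def localAlg (X : Set ℤ) : StarSubalgebra ℂ Chain :=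
  (StarAlgebra.adjoin ℂ (⋃ j ∈ X, Set.range (site j))).topologicalClosure

/-! ## Quantum cellular automata and circuits -/

/-- `*`-automorphisms of `𝒜`; the group multiplication is composition. -/
abbrev Aut : Type := Chain ≃⋆ₐ[ℂ] Chain

/-- `Ad[u] : x ↦ u x u*`. -/
abbrev Ad (u : unitary Chain) : Aut := Unitary.conjStarAlgAut ℂ Chain u

/-- The `r`-fattening of a set of sites. -/
def fatten (X : Set ℤ) (r : ℕ) : Set ℤ := {j | ∃ i ∈ X, |j - i| ≤ r}

/-- `α` is a quantum cellular automaton. -/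
def IsQCA (α : Aut) : Prop :=
  ∃ r : ℕ, ∀ X : Set ℤ, ∀ x ∈ localAlg X, α x ∈ localAlg (fatten X r)

/-- A partition of `ℤ` into intervals of bounded size. -/
structure BlockPartition where
  block : ℤ → Finset ℤ
  isInterval : ∀ a, (block a : Set ℤ).OrdConnected
  disjoint : Pairwise fun a b => Disjoint (block a) (block b)
  covers : ∀ j, ∃ a, j ∈ block a
  bounded : ∃ N : ℕ, ∀ a, (block a).card ≤ N

/-- `β = ⨂ₐ Ad(Uₐ)` for unitary gates `Uₐ` supported on the blocks of `P`. An automorphism is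
determined by its restrictions to the block algebras, which together generate `𝒜`. -/
def IsBlockPartitioned (P : BlockPartition) (β : Aut) : Prop :=
  ∃ U : ℤ → unitary Chain, ∀ a, (U a : Chain) ∈ localAlg (P.block a) ∧
    ∀ x ∈ localAlg (P.block a), β x = Ad (U a) x

/-- `γ` is a finite depth quantum circuit: a finite composition of block partitioned automorphisms
(the partition may differ from layer to layer). -/
def IsFDQC (γ : Aut) : Prop :=
  ∃ l : List Aut, (∀ β ∈ l, ∃ P, IsBlockPartitioned P β) ∧ γ = l.prod

/-! ## Locality preserving symmetries -/

/-- A locality preserving `G`-symmetry of the qubit chain. -/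
structure LPSymmetry (G : Type) [Group G] where
  toHom : G →* Aut
  isQCA : ∀ g, IsQCA (toHom g)

/-- Every component is block partitioned, with blocks independent of the group element. -/
def LPSymmetry.IsDecoupled {G : Type} [Group G] (α : LPSymmetry G) : Prop :=
  ∃ P : BlockPartition, ∀ g, IsBlockPartitioned P (α.toHom g)

/-- Equivalence (without stacking any ancillas): conjugation by a finite depth quantum circuit. -/
def LPSymmetry.Equivalent {G : Type} [Group G] (α β : LPSymmetry G) : Prop :=
  ∃ γ : Aut, IsFDQC γ ∧ ∀ g, β.toHom g = γ⁻¹ * α.toHom g * γ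

/-! ## The anomaly -/

/-- `U(1)`, written additively, with the trivial action of `G`. -/
abbrev U1 (G : Type) [Group G] : Rep ℤ G := Rep.trivial ℤ G (Additive Circle)

/-- `ρ` is a right restriction of `α` at site `j` with defect size `L`. -/
def IsRightRestriction {G : Type} [Group G] (α : LPSymmetry G) (j : ℤ) (L : ℕ) (ρ : G → Aut) :
    Prop :=
  ∀ g, (∀ x ∈ localAlg (Set.Ici (j + L)), ρ g x = α.toHom g x) ∧
    (∀ x ∈ localAlg (Set.Iio (j - L)), ρ g x = x)

/-- `F` is a family of fusion operators for `ρ`: local unitaries with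
`ρ(g) ∘ ρ(h) = Ad[F(g, h)] ∘ ρ(gh)`. -/
def IsFusion {G : Type} [Group G] (ρ : G → Aut) (F : G → G → unitary Chain) : Prop :=
  ∀ g h, (∃ S : Finset ℤ, (F g h : Chain) ∈ localAlg S) ∧ ρ g * ρ h = Ad (F g h) * ρ (g * h)

/-- The phases `ω` by which the fusion operators fail to be associative:
`F(f, g) F(fg, h) = ω(f, g, h) ρ(f)(F(g, h)) F(f, gh)`. -/
def IsAssociator {G : Type} [Group G] (ρ : G → Aut) (F : G → G → unitary Chain)
    (ω : G → G → G → Circle) : Prop :=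
  ∀ f g h, (F f g * F (f * g) h : Chain) =
    (ω f g h : ℂ) • (ρ f (F g h) * F f (g * h) : Chain)

/-- `c ∈ H³(G, U(1))` is an anomaly of `α`: it is the class of the `3`-cocycle of associator phases
for some site, some right restriction at this site and some choice of fusion operators. -/
def LPSymmetry.HasAnomaly {G : Type} [Group G] (α : LPSymmetry G)
    (c : groupCohomology (U1 G) 3) : Prop :=
  ∃ (j : ℤ) (L : ℕ) (ρ : G → Aut) (F : G → G → unitary Chain) (ω : G → G → G → Circle),
    IsRightRestriction α j L ρ ∧ IsFusion ρ F ∧ IsAssociator ρ F ω ∧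
    ∃ h : inhomogeneousCochains.d (U1 G) 3
        (fun g => Additive.ofMul (ω (g 0) (g 1) (g 2))) = 0,
      c = groupCohomology.π (U1 G) 3 (groupCohomology.cocyclesMk _ h)

/-- `α` has trivial anomaly: its anomaly is well defined and equal to the identity element of
`H³(G, U(1))`. -/
def LPSymmetry.HasTrivialAnomaly {G : Type} [Group G] (α : LPSymmetry G) : Prop :=
  ∀ c : groupCohomology (U1 G) 3, α.HasAnomaly c ↔ c = 0

/-! ## The controlled-`Z` gates -/

/-- The Pauli matrix `Z` at site `j`. -/
def pauliZ (j : ℤ) : Chain := site j !![1, 0; 0, -1]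

/-- `P↓ = (1 - Z) / 2` at site `j`. -/
def projDown (j : ℤ) : Chain := (1 / 2 : ℂ) • (1 - pauliZ j)

/-- The controlled-`Z` gate on sites `j` and `j + 1`. -/
def CZ (j : ℤ) : Chain := 1 - (2 : ℂ) • (projDown j * projDown (j + 1))

/-- `U_{[a, b]} = ∏_{j = a}^{b - 1} CZ_{j, j + 1}`. -/
def czProd (a b : ℤ) : Chain :=
  ((List.range (b - a).toNat).map fun k : ℕ => CZ (a + k)).prod

end SpinChain

end

/-!
The symmetry is generated by conjugation with the product of the controlled-`Z` gates over all bonds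
of the chain. On every on-site algebra the conjugations by `U_{[-n, n]}` stabilise, so they converge
to an involutive automorphism (`exists_limit_aut`).

*Trivial anomaly.* Conjugation by the gates over the half-line `0, 1, 2, …` is a right restriction
which is itself an involution, hence a homomorphism `ρ₀` from `ℤ₂`, with fusion operators and
associator equal to `1`. Any other right restriction differs from `ρ₀` by automorphisms which move
only finitely many sites. These are inner (`exists_implementing_unitary`), so
`ρ(g) = Ad(v_g) ρ₀(g)`. As the centre of `𝒜` is trivial, fusion operators for `ρ` are
`F(g, h) = l(g, h) v_g ρ₀(g)(v_h) v_{gh}*` with phases `l(g, h)`, and the associator is the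
coboundary of `l` (`exists_coboundary`).

*No decoupling.* Suppose `γ⁻¹ α γ` is decoupled for a circuit `γ`, choose a cut of the chain between
two blocks, and a long interval `[a, b]` around the cut. Near the cut, conjugation by
`w = γ⁻¹(U_{[a, b]})` acts as the decoupled symmetry and preserves the blocks; further away it moves
operators by a bounded distance only. So it preserves the algebras of both half-chains, which forces
`w = l x y` with a phase `l` and unitaries `x`, `y` of the left and the right half-chain
(`exists_factorization`). The tracial state `t` of `𝒜` is unique, hence invariant under `γ`, and
multiplicative on disjoint regions. With `u = CZ_{a-1, a}` and `v = CZ_{b, b+1}`, whose preimages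
under `γ` lie on either side of the cut, the factorization gives
`t(U) t(u U v) = t(u U) t(U v)` for `U = U_{[a, b]}`: the traces behave as if the transfer matrix of
the chain had rank one. The transfer matrix of the controlled-`Z` chain has rank two. The trace of
the chain on `n` sites is `2 ^ (-⌊n / 2⌋)` (`IsTrace.czProd_eq`), which violates the identity.
-/

noncomputable section

namespace SpinChain

/-! ### Local subalgebras and automorphisms -/

instance isClosed_quasiLocal : IsClosed (quasiLocal : Set (Hilb →L[ℂ] Hilb)) :=
  StarSubalgebra.isClosed_topologicalClosure _

theorem Aut.norm_map (θ : Aut) (x : Chain) : ‖θ x‖ = ‖x‖ := StarAlgEquiv.norm_map θ x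

theorem Aut.continuous (θ : Aut) : Continuous θ := (StarAlgEquiv.isometry θ).continuous

theorem isClosed_localAlg (X : Set ℤ) : IsClosed (localAlg X : Set Chain) :=
  StarSubalgebra.isClosed_topologicalClosure _

theorem site_mem {X : Set ℤ} {j : ℤ} (hj : j ∈ X) (M : Matrix (Fin 2) (Fin 2) ℂ) :
    site j M ∈ localAlg X :=
  StarSubalgebra.le_topologicalClosure _
    (StarAlgebra.subset_adjoin ℂ _ (Set.mem_iUnion₂.mpr ⟨j, hj, M, rfl⟩))

theorem localAlg_le {X : Set ℤ} {B : StarSubalgebra ℂ Chain} (hB : IsClosed (B : Set Chain))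
    (h : ∀ j ∈ X, ∀ M, site j M ∈ B) : localAlg X ≤ B := by
  refine StarSubalgebra.topologicalClosure_minimal (StarAlgebra.adjoin_le ?_) hB
  simp only [Set.iUnion_subset_iff]
  rintro j hj _ ⟨M, rfl⟩
  exact h j hj M

theorem localAlg_mono {X Y : Set ℤ} (h : X ⊆ Y) : localAlg X ≤ localAlg Y :=
  localAlg_le (isClosed_localAlg Y) fun _ hj M => site_mem (h hj) M

theorem localAlg_univ : localAlg Set.univ = ⊤ := by
  rw [eq_top_iff]
  intro x _
  have hcl : IsClosed ((localAlg Set.univ).map quasiLocal.subtype : Set (Hilb →L[ℂ] Hilb)) := by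
    rw [StarSubalgebra.coe_map]
    exact isClosed_quasiLocal.isClosedEmbedding_subtypeVal.isClosedMap _ (isClosed_localAlg _)
  have hle : quasiLocal ≤ (localAlg Set.univ).map quasiLocal.subtype := by
    refine StarSubalgebra.topologicalClosure_minimal (StarAlgebra.adjoin_le ?_) hcl
    simp only [Set.iUnion_subset_iff]
    rintro j _ ⟨M, rfl⟩
    exact ⟨site j M, site_mem (Set.mem_univ j) M, rfl⟩
  obtain ⟨y, hy, hyx⟩ := hle x.2
  rwa [← Subtype.ext (a1 := y) (a2 := x) hyx]

theorem mem_localAlg_univ (x : Chain) : x ∈ localAlg Set.univ := by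
  rw [localAlg_univ]; trivial

theorem site_commute {j k : ℤ} (h : j ≠ k) (M N : Matrix (Fin 2) (Fin 2) ℂ) :
    Commute (site j M) (site k N) := by
  refine Subtype.ext ?_
  change siteCLM j M * siteCLM k N = siteCLM k N * siteCLM j M
  ext f σ
  simp [siteCLM_apply, Function.update_of_ne h, Function.update_of_ne h.symm,
    Function.update_comm h]
  ring

/-- An element commuting with the on-site algebras of `X` commutes with `𝒜_X`. -/
theorem commute_of_forall_site {X : Set ℤ} {x y : Chain} (h : ∀ j ∈ X, ∀ M, Commute (site j M) y)
    (hx : x ∈ localAlg X) : Commute x y := by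
  have hle : localAlg X ≤ StarSubalgebra.centralizer ℂ {y} := by
    refine localAlg_le ?_ fun j hj M => ?_
    · rw [StarSubalgebra.coe_centralizer]; exact Set.isClosed_centralizer _
    · rw [StarSubalgebra.mem_centralizer_iff]
      rintro _ rfl
      refine ⟨(h j hj M).symm, ?_⟩
      have := (h j hj (star M)).star_star
      rw [← map_star, star_star] at this
      exact this.symm
  exact ((StarSubalgebra.mem_centralizer_iff ℂ).mp (hle hx) y rfl).1.symm

theorem localAlg_commute {X Y : Set ℤ} (h : Disjoint X Y) {x y : Chain} (hx : x ∈ localAlg X)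
    (hy : y ∈ localAlg Y) : Commute x y :=
  commute_of_forall_site (fun _ hj M => (commute_of_forall_site (fun _ hk N =>
    site_commute (h.symm.ne_of_mem hk hj) N M) hy).symm) hx

/-- Continuous `*`-endomorphisms are determined on `𝒜_X` by the on-site algebras of `X`. -/
theorem eqOn_localAlg {X : Set ℤ} {f g : Chain →⋆ₐ[ℂ] Chain} (hf : Continuous f)
    (hg : Continuous g) (h : ∀ j ∈ X, ∀ M, f (site j M) = g (site j M)) {x : Chain}
    (hx : x ∈ localAlg X) : f x = g x :=
  localAlg_le (B := StarAlgHom.equalizer f g) (isClosed_eq hf hg) h hx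

theorem Aut.eqOn_localAlg {X : Set ℤ} {θ η : Aut}
    (h : ∀ j ∈ X, ∀ M, θ (site j M) = η (site j M)) {x : Chain} (hx : x ∈ localAlg X) :
    θ x = η x :=
  SpinChain.eqOn_localAlg (f := (θ : Chain →⋆ₐ[ℂ] Chain)) (g := (η : Chain →⋆ₐ[ℂ] Chain))
    θ.continuous η.continuous h hx

theorem Aut.ext_site {θ η : Aut} (h : ∀ j M, θ (site j M) = η (site j M)) : θ = η :=
  StarAlgEquiv.ext fun x => Aut.eqOn_localAlg (fun j _ M => h j M) (mem_localAlg_univ x)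

theorem Aut.map_localAlg {X Y : Set ℤ} {θ : Aut} (h : ∀ j ∈ X, ∀ M, θ (site j M) ∈ localAlg Y)
    {x : Chain} (hx : x ∈ localAlg X) : θ x ∈ localAlg Y :=
  localAlg_le (B := (localAlg Y).comap (θ : Chain →⋆ₐ[ℂ] Chain))
    ((isClosed_localAlg Y).preimage θ.continuous) h hx

theorem Ad_apply (u : unitary Chain) (x : Chain) : Ad u x = u * x * star (u : Chain) := rfl

theorem Ad_eq_self {u : unitary Chain} {x : Chain} (h : Commute (u : Chain) x) : Ad u x = x := by
  rw [Ad_apply, h.eq, mul_assoc, Unitary.mul_star_self_of_mem u.2, mul_one]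

theorem Ad_mul (u v : unitary Chain) : Ad (u * v) = Ad u * Ad v := map_mul _ u v

theorem Ad_mem {X : Set ℤ} {u : unitary Chain} (hu : (u : Chain) ∈ localAlg X) {x : Chain}
    (hx : x ∈ localAlg X) : Ad u x ∈ localAlg X :=
  mul_mem (mul_mem hu hx) (star_mem hu)

/-- The image of a unitary under an automorphism. -/
def Aut.mapU (θ : Aut) (u : unitary Chain) : unitary Chain := ⟨θ u, Unitary.map_mem θ u.2⟩

theorem Aut.coe_mapU (θ : Aut) (u : unitary Chain) : (θ.mapU u : Chain) = θ u := rfl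

theorem mul_Ad (θ : Aut) (u : unitary Chain) : θ * Ad u = Ad (θ.mapU u) * θ := by
  ext1 x
  simp [Aut.coe_mapU, map_star]

/-- Elements with finite support are dense in `𝒜_X`. -/
theorem localAlg_induction {X : Set ℤ} {p : Chain → Prop} (hp : IsClosed {x | p x})
    (h : ∀ S : Finset ℤ, (S : Set ℤ) ⊆ X → ∀ x ∈ localAlg S, p x) {x : Chain}
    (hx : x ∈ localAlg X) : p x := by
  refine closure_minimal (s := (StarAlgebra.adjoin ℂ (⋃ j ∈ X, Set.range (site j)) : Set Chain))
    (fun y hy => ?_) hp hx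
  obtain ⟨S, hS, hyS⟩ : ∃ S : Finset ℤ, (S : Set ℤ) ⊆ X ∧ y ∈ localAlg S := by
    induction hy using StarAlgebra.adjoin_induction with
    | mem y hy =>
      obtain ⟨j, hj, M, rfl⟩ := Set.mem_iUnion₂.mp hy
      exact ⟨{j}, by simpa using hj, site_mem (by simp) M⟩
    | algebraMap c => exact ⟨∅, by simp, algebraMap_mem _ c⟩
    | add y z _ _ hy hz =>
      obtain ⟨S, hS, hy⟩ := hy
      obtain ⟨T, hT, hz⟩ := hz
      exact ⟨S ∪ T, by simp [hS, hT], add_mem (localAlg_mono (by simp) hy)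
        (localAlg_mono (by simp) hz)⟩
    | mul y z _ _ hy hz =>
      obtain ⟨S, hS, hy⟩ := hy
      obtain ⟨T, hT, hz⟩ := hz
      exact ⟨S ∪ T, by simp [hS, hT], mul_mem (localAlg_mono (by simp) hy)
        (localAlg_mono (by simp) hz)⟩
    | star y _ hy =>
      obtain ⟨S, hS, hy⟩ := hy
      exact ⟨S, hS, star_mem hy⟩
  exact h S hS y hyS

/-! ### Quantum cellular automata -/

theorem fatten_mono {X Y : Set ℤ} (h : X ⊆ Y) (r : ℕ) : fatten X r ⊆ fatten Y r :=
  fun _ ⟨i, hi, hj⟩ => ⟨i, h hi, hj⟩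

theorem fatten_mono_right (X : Set ℤ) {r s : ℕ} (h : r ≤ s) : fatten X r ⊆ fatten X s :=
  fun _ ⟨i, hi, hj⟩ => ⟨i, hi, hj.trans (by exact_mod_cast h)⟩

theorem fatten_fatten (X : Set ℤ) (r s : ℕ) : fatten (fatten X r) s ⊆ fatten X (r + s) := by
  rintro k ⟨j, ⟨i, hi, hij⟩, hjk⟩
  refine ⟨i, hi, ?_⟩
  rw [abs_le] at *
  push_cast
  omega

theorem fatten_Icc_subset (a b : ℤ) (r : ℕ) : fatten (Set.Icc a b) r ⊆ Set.Icc (a - r) (b + r) := by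
  rintro j ⟨i, hi, hij⟩
  rw [abs_le] at hij
  rw [Set.mem_Icc] at *
  omega

theorem mem_fatten_singleton {j k : ℤ} {r : ℕ} : k ∈ fatten {j} r ↔ |k - j| ≤ r := by
  simp [fatten]

theorem isQCA_of_site {θ : Aut} (r : ℕ) (h : ∀ j M, θ (site j M) ∈ localAlg (fatten {j} r)) :
    IsQCA θ :=
  ⟨r, fun _ _ hx => Aut.map_localAlg (fun j hj M =>
    localAlg_mono (fatten_mono (Set.singleton_subset_iff.mpr hj) r) (h j M)) hx⟩

theorem IsQCA.one : IsQCA 1 :=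
  isQCA_of_site 0 fun j M => site_mem (mem_fatten_singleton.mpr (by simp)) M

theorem IsQCA.mul {θ η : Aut} (hθ : IsQCA θ) (hη : IsQCA η) : IsQCA (θ * η) := by
  obtain ⟨r, hr⟩ := hθ
  obtain ⟨s, hs⟩ := hη
  exact ⟨s + r, fun X x hx => localAlg_mono (fatten_fatten X s r) (hr _ _ (hs X x hx))⟩

theorem IsBlockPartitioned.isQCA {P : BlockPartition} {β : Aut} (h : IsBlockPartitioned P β) :
    IsQCA β := by
  obtain ⟨U, hU⟩ := h
  obtain ⟨N, hN⟩ := P.bounded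
  refine isQCA_of_site N fun j M => ?_
  obtain ⟨a, ha⟩ := P.covers j
  obtain ⟨hUa, hβ⟩ := hU a
  have hs : site j M ∈ localAlg (P.block a) := site_mem ha M
  rw [hβ _ hs]
  refine localAlg_mono (fun k hk => mem_fatten_singleton.mpr ?_) (Ad_mem hUa hs)
  -- an interval containing `j` and `k` has more than `|k - j|` elements
  have hsub : Finset.uIcc j k ⊆ P.block a := fun i hi =>
    (P.isInterval a).uIcc_subset ha hk (Finset.coe_uIcc j k ▸ Finset.mem_coe.mpr hi)
  have h1 := (Finset.card_le_card hsub).trans (hN a)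
  rw [Int.card_uIcc] at h1
  rw [Int.abs_eq_natAbs]
  omega

theorem IsBlockPartitioned.inv {P : BlockPartition} {β : Aut} (h : IsBlockPartitioned P β) :
    IsBlockPartitioned P β⁻¹ := by
  obtain ⟨U, hU⟩ := h
  refine ⟨fun a => (U a)⁻¹, fun a => ?_⟩
  obtain ⟨hUa, hβ⟩ := hU a
  have hUa' : (((U a)⁻¹ : unitary Chain) : Chain) ∈ localAlg (P.block a) := star_mem hUa
  refine ⟨hUa', fun x hx => ?_⟩
  apply EquivLike.injective β
  beta_reduce
  rw [hβ _ (Ad_mem hUa' hx), ← StarAlgEquiv.mul_apply, ← StarAlgEquiv.mul_apply, mul_inv_cancel,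
    ← Ad_mul, mul_inv_cancel, Ad_eq_self (Commute.one_left x)]
  rfl

theorem IsFDQC.isQCA {γ : Aut} (h : IsFDQC γ) : IsQCA γ := by
  obtain ⟨l, hl, rfl⟩ := h
  induction l with
  | nil => exact IsQCA.one
  | cons β l ih =>
    rw [List.prod_cons]
    obtain ⟨P, hP⟩ := hl β (by simp)
    exact hP.isQCA.mul (ih fun β' h' => hl β' (List.mem_cons_of_mem _ h'))

theorem IsFDQC.inv {γ : Aut} (h : IsFDQC γ) : IsFDQC γ⁻¹ := by
  obtain ⟨l, hl, rfl⟩ := h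
  refine ⟨(l.map fun β => β⁻¹).reverse, fun β hβ => ?_, List.prod_inv_reverse l⟩
  simp only [List.mem_reverse, List.mem_map] at hβ
  obtain ⟨β', h', rfl⟩ := hβ
  obtain ⟨P, hP⟩ := hl β' h'
  exact ⟨P, hP.inv⟩

/-! ### Finite regions are matrix algebras -/

open Classical in
/-- The basis vector `e_0` of the all-up configuration. -/
def baseVec : Hilb := lp.single 2 (0 : Config) (1 : ℂ)

open Classical in
theorem norm_baseVec : ‖baseVec‖ = 1 := by
  rw [baseVec, lp.norm_single (by norm_num), norm_one]

instance nontrivial_chain : Nontrivial Chain := by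
  refine ⟨⟨0, 1, fun h => ?_⟩⟩
  have h1 : (0 : Chain).1 baseVec = (1 : Chain).1 baseVec := by rw [h]
  have h2 : baseVec = 0 := h1.symm
  have := norm_baseVec
  rw [h2, norm_zero] at this
  exact zero_ne_one this

section Tensor

variable {ι κ : Type} [Fintype ι] [DecidableEq ι] [Fintype κ] [DecidableEq κ]

/-- The block `(M (i, a) (k, b))_{i, k}` of a matrix on a product index set. -/
def blockOf (M : Matrix (ι × κ) (ι × κ) ℂ) (a b : κ) : Matrix ι ι ℂ :=
  Matrix.of fun i k => M (i, a) (k, b)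

/-- The tensor product `e_{ik} ⊗ e_{ab} ↦ φ(e_{ik}) ψ(e_{ab})` of two commuting representations of
matrix algebras. -/
def tensorHom (φ : Matrix ι ι ℂ →⋆ₐ[ℂ] Chain) (ψ : Matrix κ κ ℂ →⋆ₐ[ℂ] Chain)
    (h : ∀ M N, Commute (φ M) (ψ N)) : Matrix (ι × κ) (ι × κ) ℂ →⋆ₐ[ℂ] Chain where
  toFun M := ∑ a, ∑ b, φ (blockOf M a b) * ψ (Matrix.single a b 1)
  map_one' := by
    have h1 : ∀ a b : κ, blockOf (1 : Matrix (ι × κ) (ι × κ) ℂ) a b = if a = b then 1 else 0 := by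
      intro a b
      ext i k
      by_cases hab : a = b <;> simp [blockOf, Matrix.one_apply, hab]
    simp only [h1, apply_ite φ, map_one, map_zero, ite_mul, one_mul, zero_mul, Finset.sum_ite_eq,
      Finset.mem_univ, if_true]
    rw [← map_sum, Matrix.sum_single_one, map_one]
  map_mul' M N := by
    have h1 : ∀ a d : κ, blockOf (M * N) a d = ∑ b, blockOf M a b * blockOf N b d := by
      intro a d
      ext i k
      simp only [blockOf, Matrix.of_apply, Matrix.mul_apply, Matrix.sum_apply,
        Fintype.sum_prod_type]
      exact Finset.sum_comm
    have h2 : ∀ a b c d : κ, φ (blockOf M a b) * ψ (Matrix.single a b 1) *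
        (φ (blockOf N c d) * ψ (Matrix.single c d 1)) =
        if b = c then φ (blockOf M a b * blockOf N b d) * ψ (Matrix.single a d 1) else 0 := by
      intro a b c d
      rw [mul_assoc, ← mul_assoc (ψ _), ← (h _ _).eq, mul_assoc, ← map_mul, ← mul_assoc, ← map_mul]
      split_ifs with hbc
      · subst hbc
        rw [Matrix.single_mul_single_same, mul_one]
      · rw [Matrix.single_mul_single_of_ne _ _ _ _ hbc, map_zero, mul_zero]
    symm
    simp only [Finset.sum_mul]
    simp only [Finset.mul_sum, h2, Finset.sum_ite_irrel, Finset.sum_const_zero, Finset.sum_ite_eq,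
      Finset.mem_univ, if_true]
    refine Finset.sum_congr rfl fun a _ => ?_
    rw [Finset.sum_comm]
    exact Finset.sum_congr rfl fun d _ => by rw [h1, map_sum, Finset.sum_mul]
  map_zero' := by
    have h1 : ∀ a b : κ, blockOf (0 : Matrix (ι × κ) (ι × κ) ℂ) a b = 0 := fun a b => rfl
    simp [h1]
  map_add' M N := by
    have h1 : ∀ a b : κ, blockOf (M + N) a b = blockOf M a b + blockOf N a b := fun a b => rfl
    simp only [h1, map_add, add_mul, Finset.sum_add_distrib]
  commutes' c := by
    have h1 : ∀ a b : κ, blockOf (algebraMap ℂ (Matrix (ι × κ) (ι × κ) ℂ) c) a b =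
        if a = b then algebraMap ℂ _ c else 0 := by
      intro a b
      ext i k
      by_cases hab : a = b <;>
        simp [blockOf, Matrix.one_apply, hab, Algebra.algebraMap_eq_smul_one]
    simp only [h1, apply_ite φ, AlgHomClass.commutes, map_zero, ite_mul, zero_mul,
      Finset.sum_ite_eq, Finset.mem_univ, if_true]
    rw [← Finset.mul_sum, ← map_sum, Matrix.sum_single_one, map_one, mul_one]
  map_star' M := by
    have h1 : ∀ a b : κ, blockOf (star M) a b = star (blockOf M b a) := fun a b => rfl
    simp only [star_sum, star_mul, h1, map_star]
    rw [Finset.sum_comm]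
    refine Finset.sum_congr rfl fun a _ => Finset.sum_congr rfl fun b _ => ?_
    rw [← map_star, ← map_star, (h _ _).eq, Matrix.star_eq_conjTranspose (Matrix.single a b _)]
    simp

theorem tensorHom_apply (φ : Matrix ι ι ℂ →⋆ₐ[ℂ] Chain) (ψ : Matrix κ κ ℂ →⋆ₐ[ℂ] Chain)
    (h : ∀ M N, Commute (φ M) (ψ N)) (M : Matrix (ι × κ) (ι × κ) ℂ) :
    tensorHom φ ψ h M = ∑ a, ∑ b, φ (blockOf M a b) * ψ (Matrix.single a b 1) := rfl

theorem tensorHom_left (φ : Matrix ι ι ℂ →⋆ₐ[ℂ] Chain) (ψ : Matrix κ κ ℂ →⋆ₐ[ℂ] Chain)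
    (h : ∀ M N, Commute (φ M) (ψ N)) (M : Matrix ι ι ℂ) :
    tensorHom φ ψ h (Matrix.of fun p q => if p.2 = q.2 then M p.1 q.1 else 0) = φ M := by
  have h1 : ∀ a b : κ, blockOf (Matrix.of fun p q : ι × κ => if p.2 = q.2 then M p.1 q.1 else 0)
      a b = if a = b then M else 0 := by
    intro a b
    ext i k
    by_cases hab : a = b <;> simp [blockOf, hab]
  simp only [tensorHom_apply, h1, apply_ite φ, map_zero, ite_mul, zero_mul, Finset.sum_ite_eq,
    Finset.mem_univ, if_true]
  rw [← Finset.mul_sum, ← map_sum, Matrix.sum_single_one, map_one, mul_one]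

theorem tensorHom_right (φ : Matrix ι ι ℂ →⋆ₐ[ℂ] Chain) (ψ : Matrix κ κ ℂ →⋆ₐ[ℂ] Chain)
    (h : ∀ M N, Commute (φ M) (ψ N)) (N : Matrix κ κ ℂ) :
    tensorHom φ ψ h (Matrix.of fun p q => if p.1 = q.1 then N p.2 q.2 else 0) = ψ N := by
  have h1 : ∀ a b : κ, blockOf (Matrix.of fun p q : ι × κ => if p.1 = q.1 then N p.2 q.2 else 0)
      a b = N a b • 1 := by
    intro a b
    ext i k
    simp [blockOf, Matrix.one_apply]
  simp only [tensorHom_apply, h1, map_smul, map_one, smul_mul_assoc, one_mul]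
  conv_rhs => rw [Matrix.matrix_eq_sum_single N]
  simp only [← map_smul, ← map_sum, Matrix.smul_single, smul_eq_mul, mul_one]

end Tensor

theorem isClosed_range {ι : Type} [Fintype ι] [DecidableEq ι] (φ : Matrix ι ι ℂ →⋆ₐ[ℂ] Chain) :
    IsClosed (φ.range : Set Chain) :=
  Submodule.closed_of_finiteDimensional (LinearMap.range φ.toAlgHom.toLinearMap)

/-- For finite `S`, the algebra `𝒜_S` is (the image of) a full matrix algebra. -/
theorem exists_matrixUnits (S : Finset ℤ) :
    ∃ (ι : Type) (_ : Fintype ι) (_ : DecidableEq ι) (φ : Matrix ι ι ℂ →⋆ₐ[ℂ] Chain),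
      φ.range = localAlg S := by
  induction S using Finset.induction_on with
  | empty =>
    let φ : Matrix Unit Unit ℂ →⋆ₐ[ℂ] Chain :=
      { toFun M := algebraMap ℂ Chain (M () ())
        map_one' := by simp
        map_mul' M N := by simp [Matrix.mul_apply]
        map_zero' := by simp
        map_add' M N := by simp
        commutes' c := by simp [Algebra.algebraMap_eq_smul_one]
        map_star' M := algebraMap_star_comm (M () ()) }
    refine ⟨Unit, inferInstance, inferInstance, φ, le_antisymm ?_ ?_⟩
    · rintro _ ⟨M, rfl⟩
      exact algebraMap_mem (localAlg _) (M () ())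
    · exact localAlg_le (isClosed_range φ) (by simp)
  | insert j S hj ih =>
    obtain ⟨ι, _, _, φ, hφ⟩ := ih
    have hmem : ∀ M, φ M ∈ localAlg S := fun M => by
      rw [← hφ]; exact ⟨M, rfl⟩
    have hcomm : ∀ M N, Commute (φ M) (site j N) := fun M N =>
      localAlg_commute (Set.disjoint_singleton_right.mpr (mt Finset.mem_coe.mp hj)) (hmem M)
        (site_mem (Set.mem_singleton j) N)
    refine ⟨ι × Fin 2, inferInstance, inferInstance, tensorHom φ (site j) hcomm,
      le_antisymm ?_ (localAlg_le (isClosed_range _) ?_)⟩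
    · rintro _ ⟨M, rfl⟩
      change ∑ a, ∑ b, φ (blockOf M a b) * site j (Matrix.single a b 1) ∈ _
      refine sum_mem fun a _ => sum_mem fun b _ => ?_
      exact mul_mem (localAlg_mono (Finset.coe_subset.mpr (Finset.subset_insert j S)) (hmem _))
        (site_mem (Finset.mem_coe.mpr (Finset.mem_insert_self j S)) _)
    · intro k hk M
      rcases Finset.mem_insert.mp (Finset.mem_coe.mp hk) with rfl | hk
      · exact ⟨_, tensorHom_right φ (site k) hcomm M⟩
      · obtain ⟨N, hN⟩ : site k M ∈ φ.range := by
          rw [hφ]; exact site_mem (Finset.mem_coe.mpr hk) M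
        exact ⟨_, (tensorHom_left φ (site j) hcomm N).trans hN⟩

section MatrixUnits

variable {ι : Type} [Fintype ι] [DecidableEq ι] (φ : Matrix ι ι ℂ →⋆ₐ[ℂ] Chain)

/-- The matrix unit `e_{ij}` in a matrix subalgebra of `𝒜`. -/
def mu (i j : ι) : Chain := φ (Matrix.single i j 1)

theorem mu_mul_mu (i j k l : ι) : mu φ i j * mu φ k l = if j = k then mu φ i l else 0 := by
  rw [mu, mu, ← map_mul]
  split_ifs with h
  · rw [h, Matrix.single_mul_single_same, mul_one, mu]
  · rw [Matrix.single_mul_single_of_ne _ _ _ _ h, map_zero]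

@[simp]
theorem mu_mul_same (i j k : ι) : mu φ i j * mu φ j k = mu φ i k := by
  rw [mu_mul_mu, if_pos rfl]

theorem star_mu (i j : ι) : star (mu φ i j) = mu φ j i := by
  rw [mu, ← map_star, Matrix.star_eq_conjTranspose, Matrix.conjTranspose_single, star_one, mu]

theorem sum_mu : ∑ i, mu φ i i = 1 := by
  simp only [mu]
  rw [← map_sum, Matrix.sum_single_one, map_one]

theorem eq_sum_mu (M : Matrix ι ι ℂ) : φ M = ∑ i, ∑ j, M i j • mu φ i j := by
  conv_lhs => rw [Matrix.matrix_eq_sum_single M]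
  simp only [mu, ← map_smul, ← map_sum, Matrix.smul_single, smul_eq_mul, mul_one]

theorem nonempty_index (φ : Matrix ι ι ℂ →⋆ₐ[ℂ] Chain) : Nonempty ι := by
  by_contra h
  rw [not_nonempty_iff] at h
  have := sum_mu φ
  rw [Finset.univ_eq_empty, Finset.sum_empty] at this
  exact zero_ne_one this

end MatrixUnits

/-! ### The centre is trivial -/

section NormIdentity

variable {ι : Type} [Fintype ι] [DecidableEq ι] (φ : Matrix ι ι ℂ →⋆ₐ[ℂ] Chain)

theorem sum_norm_mu_sq (k : ι → ι) (f : Hilb) : ∑ i, ‖(mu φ (k i) i).1 f‖ ^ 2 = ‖f‖ ^ 2 := by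
  have h1 : ∀ i, ((‖(mu φ (k i) i).1 f‖ ^ 2 : ℝ) : ℂ) = inner ℂ f ((mu φ i i).1 f) := by
    intro i
    have h2 : (mu φ i i).1 = star (mu φ (k i) i).1 * (mu φ (k i) i).1 := by
      change _ = (star (mu φ (k i) i) * mu φ (k i) i).1
      rw [star_mu, mu_mul_same]
    rw [h2, ContinuousLinearMap.star_eq_adjoint, mul_apply_eq_comp,
      ContinuousLinearMap.adjoint_inner_right, inner_self_eq_norm_sq_to_K]
    simp
  have h3 : (∑ i, (mu φ i i).1 f) = f := by
    have := congrArg (fun x : Chain => x.1 f) (sum_mu φ)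
    simpa [sum_apply] using this
  have h4 : ((∑ i, ‖(mu φ (k i) i).1 f‖ ^ 2 : ℝ) : ℂ) = ((‖f‖ ^ 2 : ℝ) : ℂ) := by
    rw [Complex.ofReal_sum, Finset.sum_congr rfl fun i _ => h1 i, ← inner_sum, h3,
      inner_self_eq_norm_sq_to_K]
    simp
  exact_mod_cast h4

theorem norm_mu_apply_le (i j : ι) (f : Hilb) : ‖(mu φ i j).1 f‖ ≤ ‖f‖ := by
  refine le_of_sq_le_sq ?_ (norm_nonneg f)
  rw [← sum_norm_mu_sq φ (fun _ => i) f]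
  exact Finset.single_le_sum (f := fun j => ‖(mu φ i j).1 f‖ ^ 2) (fun _ _ => by positivity)
    (Finset.mem_univ j)

/-- If `x` commutes with a matrix subalgebra, its distance to some scalar is at most its distance
to a given element `y = φ M` of the subalgebra: with `e = e_{kk}` one has `e y e = M_{kk} e`, so
`(x - M_{kk}) e = e (x - y) e`, and the matrix units carry this bound to all of `x - M_{kk}`. -/
theorem norm_sub_scalar_le {x : Chain} (hx : ∀ i j, Commute (mu φ i j) x) (M : Matrix ι ι ℂ)
    (k : ι) : ‖x - algebraMap ℂ Chain (M k k)‖ ≤ ‖x - φ M‖ := by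
  have key : ∀ i, mu φ i i * (x - algebraMap ℂ Chain (M k k)) =
      mu φ i k * (x - φ M) * mu φ k i := by
    intro i
    have h1 : mu φ i k * φ M * mu φ k i = M k k • mu φ i i := by
      rw [mu, mu, mu, ← map_mul, ← map_mul, Matrix.single_mul_mul_single, ← map_smul,
        Matrix.smul_single]
      simp
    rw [mul_sub, mul_sub, sub_mul, h1, (hx i k).eq, mul_assoc, mu_mul_same, (hx i i).eq,
      ← Algebra.commutes, Algebra.smul_def]
  refine ContinuousLinearMap.opNorm_le_bound _ (norm_nonneg _) fun f => ?_
  refine le_of_sq_le_sq ?_ (by positivity)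
  set z := x - algebraMap ℂ Chain (M k k)
  set w := x - φ M
  have hterm : ∀ i, ‖(mu φ i i).1 (z.1 f)‖ ≤ ‖w‖ * ‖(mu φ k i).1 f‖ := by
    intro i
    have h2 : (mu φ i i).1 (z.1 f) = (mu φ i k).1 (w.1 ((mu φ k i).1 f)) :=
      congrArg (fun y : Chain => y.1 f) (key i)
    rw [h2]
    exact (norm_mu_apply_le φ _ _ _).trans (ContinuousLinearMap.le_opNorm _ _)
  have hdiag : ∑ i, ‖(mu φ i i).1 (z.1 f)‖ ^ 2 = ‖z.1 f‖ ^ 2 :=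
    sum_norm_mu_sq φ (fun i => i) (z.1 f)
  change ‖z.1 f‖ ^ 2 ≤ _
  calc ‖z.1 f‖ ^ 2 = ∑ i, ‖(mu φ i i).1 (z.1 f)‖ ^ 2 := hdiag.symm
    _ ≤ ∑ i, (‖w‖ * ‖(mu φ k i).1 f‖) ^ 2 := Finset.sum_le_sum fun i _ => by
        gcongr
        exact hterm i
    _ = (‖w‖ * ‖f‖) ^ 2 := by
        simp only [mul_pow, ← Finset.mul_sum, sum_norm_mu_sq φ (fun _ => k)]

end NormIdentity

/-- The quasi-local algebra has trivial centre. -/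
theorem exists_eq_algebraMap {x : Chain} (h : ∀ j M, Commute (site j M) x) :
    ∃ c : ℂ, x = algebraMap ℂ Chain c := by
  have hcl : IsClosed ((⊥ : StarSubalgebra ℂ Chain) : Set Chain) := by
    have : FiniteDimensional ℂ (Subalgebra.toSubmodule (⊥ : Subalgebra ℂ Chain)) :=
      inferInstanceAs (FiniteDimensional ℂ (⊥ : Subalgebra ℂ Chain))
    exact Submodule.closed_of_finiteDimensional (Subalgebra.toSubmodule (⊥ : Subalgebra ℂ Chain))
  have hdist : ∀ y : Chain, Metric.infDist x ((⊥ : StarSubalgebra ℂ Chain) : Set Chain) ≤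
      ‖x - y‖ := by
    intro y
    refine localAlg_induction (X := Set.univ) (p := fun y => Metric.infDist x _ ≤ ‖x - y‖)
      (isClosed_le continuous_const (by fun_prop)) (fun S _ y hy => ?_) (mem_localAlg_univ y)
    obtain ⟨ι, _, _, φ, hφ⟩ := exists_matrixUnits S
    obtain ⟨M, rfl⟩ : y ∈ φ.range := by rw [hφ]; exact hy
    obtain ⟨k⟩ := nonempty_index φ
    refine (Metric.infDist_le_dist_of_mem (y := algebraMap ℂ Chain (M k k))
      (algebraMap_mem (⊥ : StarSubalgebra ℂ Chain) _)).trans ?_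
    rw [dist_eq_norm]
    refine norm_sub_scalar_le φ (fun i j => commute_of_forall_site (X := S) (fun j _ M => h j M) ?_)
      M k
    rw [← hφ]
    exact ⟨_, rfl⟩
  have h0 : Metric.infDist x ((⊥ : StarSubalgebra ℂ Chain) : Set Chain) = 0 :=
    le_antisymm (by simpa using hdist x) Metric.infDist_nonneg
  obtain ⟨c, hc⟩ := StarSubalgebra.mem_bot.mp
    ((hcl.mem_iff_infDist_zero ⟨0, zero_mem (⊥ : StarSubalgebra ℂ Chain)⟩).mpr h0)
  exact ⟨c, hc.symm⟩

/-- Unitaries implementing the same inner automorphism differ by a phase. -/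
theorem exists_circle_of_Ad_eq {u v : unitary Chain} (h : Ad u = Ad v) :
    ∃ c : Circle, (u : Chain) = (c : ℂ) • (v : Chain) := by
  have h1 : Ad (v⁻¹ * u) = 1 := by rw [Ad_mul, h, ← Ad_mul, inv_mul_cancel]; exact map_one _
  obtain ⟨c, hc⟩ := exists_eq_algebraMap (x := (v⁻¹ * u : unitary Chain)) fun j M => by
    have h2 : Ad (v⁻¹ * u) (site j M) = site j M := by rw [h1]; rfl
    rw [Ad_apply] at h2
    have h3 := congrArg (· * ((v⁻¹ * u : unitary Chain) : Chain)) h2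
    simp only [mul_assoc, Unitary.coe_star_mul_self, mul_one] at h3
    exact h3.symm
  have hn : ‖c‖ = 1 := by
    have h4 : ‖algebraMap ℂ Chain c‖ = 1 := by
      rw [← hc]
      exact CStarRing.norm_coe_unitary _
    rwa [norm_algebraMap'] at h4
  refine ⟨⟨c, by simpa [Submonoid.unitSphere] using hn⟩, ?_⟩
  have h5 : (u : Chain) = v * (v⁻¹ * u : unitary Chain) := by
    rw [← Submonoid.coe_mul, mul_inv_cancel_left]
  rw [h5, hc, ← Algebra.commutes, Algebra.smul_def]

/-! ### Automorphisms of finite regions are inner -/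

/-- If `w* w = c` and `w w*` is a scalar, then `w` is a multiple of a unitary. -/
theorem exists_unitary_of_scalar {w : Chain} (hw : w ≠ 0) {c d : ℂ}
    (hc : star w * w = algebraMap ℂ Chain c) (hd : w * star w = algebraMap ℂ Chain d) :
    ∃ (v : unitary Chain) (s : ℂ), (v : Chain) = s • w := by
  have hcd : c = d := by
    have h1 : c • w = d • w := by
      rw [Algebra.smul_def, Algebra.smul_def, ← hd, mul_assoc, hc, Algebra.commutes]
    exact smul_left_injective ℂ hw h1
  subst hcd
  -- evaluating `w* w = c` on a vector which `w` does not kill shows `c > 0`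
  obtain ⟨f, hf⟩ : ∃ f : Hilb, w.1 f ≠ 0 := by
    by_contra! h
    exact hw (Subtype.ext (ContinuousLinearMap.ext h))
  have hinner : c * ((‖f‖ ^ 2 : ℝ) : ℂ) = ((‖w.1 f‖ ^ 2 : ℝ) : ℂ) := by
    have h2 : (star w.1) (w.1 f) = c • f := by
      have := congrArg (fun x : Chain => x.1 f) hc
      simpa [Algebra.algebraMap_eq_smul_one] using this
    have h3 : inner ℂ f ((star w.1) (w.1 f)) = ((‖w.1 f‖ ^ 2 : ℝ) : ℂ) := by
      rw [ContinuousLinearMap.star_eq_adjoint, ContinuousLinearMap.adjoint_inner_right,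
        inner_self_eq_norm_sq_to_K]
      simp
    rw [← h3, h2, inner_smul_right, inner_self_eq_norm_sq_to_K]
    simp
  have hf0 : f ≠ 0 := fun h => hf (by rw [h, map_zero])
  set r : ℝ := ‖w.1 f‖ / ‖f‖ with hr
  have hrpos : 0 < r := div_pos (norm_pos_iff.mpr hf) (norm_pos_iff.mpr hf0)
  have hcr : c = ((r ^ 2 : ℝ) : ℂ) := by
    have hne : ((‖f‖ ^ 2 : ℝ) : ℂ) ≠ 0 := by
      exact_mod_cast (pow_pos (norm_pos_iff.mpr hf0) 2).ne'
    rw [hr, div_pow, Complex.ofReal_div, eq_div_iff hne, hinner]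
  have hr0 : (r : ℂ) ≠ 0 := by exact_mod_cast hrpos.ne'
  have hscal : (r : ℂ)⁻¹ * (r : ℂ)⁻¹ * c = 1 := by
    rw [hcr]
    push_cast
    field_simp
  refine ⟨⟨(r : ℂ)⁻¹ • w, Unitary.mem_iff.mpr ⟨?_, ?_⟩⟩, (r : ℂ)⁻¹, rfl⟩
  · rw [star_smul, smul_mul_smul_comm, hc, Algebra.algebraMap_eq_smul_one, smul_smul, star_inv₀,
      Complex.star_def, Complex.conj_ofReal, hscal, one_smul]
  · rw [star_smul, smul_mul_smul_comm, hd, Algebra.algebraMap_eq_smul_one, smul_smul, star_inv₀,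
      Complex.star_def, Complex.conj_ofReal, hscal, one_smul]

/-- An automorphism which preserves `𝒜_X` and `𝒜_{Xᶜ}` and is the identity at all but finitely many
sites of `X` is implemented on `𝒜_X` by a unitary of `𝒜_X`. With matrix units `e` of the finite
exceptional region `S`, the element `w = ∑ᵢ θ(e_{i l}) e_{k i}` intertwines `θ` and the identity on
`𝒜_X`, so `w* w` and `w w*` are central; for some `k` it does not vanish. -/
theorem exists_implementing_unitary {θ : Aut} {S : Finset ℤ} {X : Set ℤ} (hSX : (S : Set ℤ) ⊆ X)
    (hS : ∀ j ∈ S, ∀ M, θ (site j M) ∈ localAlg X)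
    (hfix : ∀ j ∈ X, j ∉ S → ∀ M, θ (site j M) = site j M)
    (hX : ∀ j ∉ X, ∀ M, θ (site j M) ∈ localAlg Xᶜ) :
    ∃ v : unitary Chain, (v : Chain) ∈ localAlg X ∧
      ∀ x ∈ localAlg X, θ x = Ad v x := by
  obtain ⟨ι, _, _, φ, hφ⟩ := exists_matrixUnits S
  obtain ⟨l⟩ := nonempty_index φ
  have hmuS : ∀ i j, mu φ i j ∈ localAlg S := fun i j => by rw [← hφ]; exact ⟨_, rfl⟩
  have hmuX : ∀ i j, mu φ i j ∈ localAlg X := fun i j => localAlg_mono hSX (hmuS i j)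
  have hθX : ∀ i j, θ (mu φ i j) ∈ localAlg X := fun i j => Aut.map_localAlg hS (hmuS i j)
  let w : ι → Chain := fun k => ∑ i, θ (mu φ i l) * mu φ k i
  have hθmul : ∀ a b c d, θ (mu φ a b) * θ (mu φ c d) = if b = c then θ (mu φ a d) else 0 := by
    intro a b c d
    rw [← map_mul, mu_mul_mu]
    split_ifs <;> simp
  have hwX : ∀ k, w k ∈ localAlg X := fun k => sum_mem fun i _ => mul_mem (hθX _ _) (hmuX _ _)
  -- `w` intertwines the inclusion of `𝒜_X` with `θ`
  have hint_mu : ∀ k a b, w k * mu φ a b = θ (mu φ a b) * w k := by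
    intro k a b
    simp only [w, Finset.sum_mul, Finset.mul_sum, mul_assoc, mu_mul_mu, mul_ite, mul_zero]
    simp only [← mul_assoc, hθmul, ite_mul, zero_mul]
    simp
  have hint : ∀ k, ∀ j ∈ X, ∀ M, w k * site j M = θ (site j M) * w k := by
    intro k j hj M
    by_cases hjS : j ∈ S
    · obtain ⟨N, hN⟩ : site j M ∈ φ.range := by
        rw [hφ]; exact site_mem (Finset.mem_coe.mpr hjS) M
      have hN' : site j M = ∑ a, ∑ b, N a b • mu φ a b := by rw [← eq_sum_mu]; exact hN.symm
      rw [hN']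
      simp only [Finset.mul_sum, map_sum, map_smul, Finset.sum_mul, mul_smul_comm, smul_mul_assoc,
        hint_mu]
    · have hd : Disjoint ({j} : Set ℤ) (S : Set ℤ) := by simpa using hjS
      have hc : ∀ i i', Commute (site j M) (mu φ i i') := fun i i' =>
        localAlg_commute hd (site_mem (Set.mem_singleton j) M) (hmuS i i')
      have hc' : ∀ i i', Commute (site j M) (θ (mu φ i i')) := fun i i' => by
        have := (hc i i').map θ
        rwa [hfix j hj hjS M] at this
      rw [hfix j hj hjS M]
      exact (Commute.sum_right _ _ _ fun i _ => (hc' _ _).mul_right (hc _ _)).symm.eq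
  have hint_star : ∀ k, ∀ j ∈ X, ∀ M, site j M * star (w k) = star (w k) * θ (site j M) := by
    intro k j hj M
    have := congrArg star (hint k j hj (star M))
    simpa [map_star] using this
  obtain ⟨k, hk⟩ : ∃ k, w k ≠ 0 := by
    by_contra! h
    have h1 : ∀ k, θ (mu φ l l) * mu φ k k = 0 := by
      intro k
      have h2 : θ (mu φ l l) * w k * mu φ l k = θ (mu φ l l) * mu φ k k := by
        simp only [w, Finset.mul_sum, ← mul_assoc, hθmul]
        simp [mul_assoc]
      rw [← h2, h k, mul_zero, zero_mul]
    have h3 : θ (mu φ l l) = 0 := by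
      rw [← mul_one (θ _), ← sum_mu φ, Finset.mul_sum]
      exact Finset.sum_eq_zero fun k _ => h1 k
    have h4 : mu φ l l = 0 := (map_eq_zero_iff θ (EquivLike.injective θ)).mp h3
    have h5 : (1 : Chain) = 0 := by
      rw [← sum_mu φ]
      refine Finset.sum_eq_zero fun i _ => ?_
      rw [← mu_mul_same φ i l i, ← mu_mul_same φ i l l, h4, mul_zero, zero_mul]
    exact one_ne_zero h5
  have hcompl : ∀ x ∈ localAlg Xᶜ, Commute x (w k) := fun x hx =>
    (localAlg_commute disjoint_compl_right (hwX k) hx).symm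
  have hcompl' : ∀ x ∈ localAlg Xᶜ, Commute x (star (w k)) := fun x hx =>
    (localAlg_commute disjoint_compl_right (star_mem (hwX k)) hx).symm
  obtain ⟨c, hc⟩ : ∃ c : ℂ, star (w k) * w k = algebraMap ℂ Chain c := by
    refine exists_eq_algebraMap fun j M => ?_
    by_cases hj : j ∈ X
    · rw [Commute, SemiconjBy, ← mul_assoc, hint_star k j hj, mul_assoc, ← hint k j hj, mul_assoc]
    · have hs := site_mem (X := Xᶜ) hj M
      exact (hcompl' _ hs).mul_right (hcompl _ hs)
  obtain ⟨d, hd⟩ : ∃ d : ℂ, w k * star (w k) = algebraMap ℂ Chain d := by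
    refine exists_eq_algebraMap fun j M => ?_
    -- `w w*` commutes with the range of `θ`, which is everything
    have hrange : ∀ x, Commute (θ x) (w k * star (w k)) := by
      intro x
      have : Commute x (θ.symm (w k * star (w k))) := by
        refine commute_of_forall_site (X := Set.univ) (fun j _ M => ?_) (mem_localAlg_univ x)
        have h6 : Commute (θ (site j M)) (w k * star (w k)) := by
          by_cases hj : j ∈ X
          · rw [Commute, SemiconjBy, ← mul_assoc, ← hint k j hj, mul_assoc, hint_star k j hj,
              mul_assoc]
          · exact (hcompl _ (hX j hj M)).mul_right (hcompl' _ (hX j hj M))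
        simpa using h6.map θ.symm
      simpa using this.map θ
    simpa using hrange (θ.symm (site j M))
  obtain ⟨v, s, hv⟩ := exists_unitary_of_scalar hk hc hd
  refine ⟨v, ?_, fun x hx => ?_⟩
  · rw [hv]
    exact (localAlg X).smul_mem (hwX k) s
  · refine Aut.eqOn_localAlg (fun j hj M => ?_) hx
    have h7 : (v : Chain) * site j M = θ (site j M) * v := by
      rw [hv, smul_mul_assoc, hint k j hj, mul_smul_comm]
    rw [Ad_apply, h7, mul_assoc, Unitary.mul_star_self_of_mem v.2, mul_one]

/-! ### Products of controlled-`Z` gates -/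

theorem projDown_eq_site (j : ℤ) : projDown j = site j !![0, 0; 0, 1] := by
  rw [projDown, pauliZ, ← map_one (site j), ← map_sub, ← map_smul]
  congr 1
  ext a b
  fin_cases a <;> fin_cases b <;> norm_num

theorem projDown_mem {X : Set ℤ} {j : ℤ} (hj : j ∈ X) : projDown j ∈ localAlg X := by
  rw [projDown_eq_site]
  exact site_mem hj _

theorem projDown_mul_self (j : ℤ) : projDown j * projDown j = projDown j := by
  rw [projDown_eq_site, ← map_mul]
  congr 1
  ext a b
  fin_cases a <;> fin_cases b <;> simp [Matrix.mul_apply]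

theorem star_projDown (j : ℤ) : star (projDown j) = projDown j := by
  rw [projDown_eq_site, ← map_star]
  congr 1
  ext a b
  fin_cases a <;> fin_cases b <;> simp [Matrix.star_apply]

theorem projDown_commute (j k : ℤ) : Commute (projDown j) (projDown k) := by
  rcases eq_or_ne j k with rfl | h
  · exact Commute.refl _
  · rw [projDown_eq_site, projDown_eq_site]
    exact site_commute h _ _

theorem CZ_mem {X : Set ℤ} {j : ℤ} (hj : j ∈ X) (hj' : j + 1 ∈ X) : CZ j ∈ localAlg X :=
  sub_mem (one_mem _)
    ((localAlg X).smul_mem (mul_mem (projDown_mem hj) (projDown_mem hj')) _)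

theorem CZ_commute_projDown (j k : ℤ) : Commute (CZ j) (projDown k) :=
  (Commute.one_left _).sub_left
    (((projDown_commute _ _).mul_left (projDown_commute _ _)).smul_left _)

theorem CZ_commute (j k : ℤ) : Commute (CZ j) (CZ k) :=
  (Commute.one_right _).sub_right
    (((CZ_commute_projDown _ _).mul_right (CZ_commute_projDown _ _)).smul_right _)

theorem star_CZ (j : ℤ) : star (CZ j) = CZ j := by
  rw [CZ, star_sub, star_one, star_smul, star_mul, star_projDown, star_projDown,
    (projDown_commute j (j + 1)).eq]
  simp

theorem CZ_mul_self (j : ℤ) : CZ j * CZ j = 1 := by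
  have h : projDown j * projDown (j + 1) * (projDown j * projDown (j + 1)) =
      projDown j * projDown (j + 1) := by
    rw [(projDown_commute (j + 1) j).mul_mul_mul_comm, projDown_mul_self, projDown_mul_self]
  rw [CZ, sub_mul, mul_sub, mul_sub, smul_mul_smul_comm, h, one_mul, mul_one, one_mul]
  module

theorem czProd_of_le {a b : ℤ} (h : b ≤ a) : czProd a b = 1 := by
  rw [czProd, Int.toNat_of_nonpos (by omega)]
  rfl

theorem czProd_succ {a b : ℤ} (h : a ≤ b) : czProd a (b + 1) = czProd a b * CZ b := by
  have h1 : (b + 1 - a).toNat = (b - a).toNat + 1 := by omega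
  have h2 : a + ((b - a).toNat : ℤ) = b := by omega
  rw [czProd, h1, List.range_succ, List.map_append, List.prod_append, List.map_singleton,
    List.prod_singleton, h2, czProd]

theorem czProd_mul_czProd {a b c : ℤ} (hab : a ≤ b) (hbc : b ≤ c) :
    czProd a b * czProd b c = czProd a c := by
  induction c, hbc using Int.leInduction with
  | base => rw [czProd_of_le le_rfl, mul_one]
  | succ c hbc ih => rw [czProd_succ hbc, czProd_succ (hab.trans hbc), ← mul_assoc, ih]

theorem czProd_single (a : ℤ) : czProd a (a + 1) = CZ a := by
  rw [czProd_succ le_rfl, czProd_of_le le_rfl, one_mul]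

theorem czProd_mem (a b : ℤ) : czProd a b ∈ localAlg (Set.Icc a b) := by
  rcases le_total b a with h | h
  · rw [czProd_of_le h]
    exact one_mem _
  · induction b, h using Int.leInduction with
    | base => rw [czProd_of_le le_rfl]; exact one_mem _
    | succ b h ih =>
      rw [czProd_succ h]
      exact mul_mem (localAlg_mono (Set.Icc_subset_Icc_right (by omega)) ih)
        (CZ_mem ⟨h, by omega⟩ ⟨by omega, le_rfl⟩)

theorem czProd_commute_of {x : Chain} (h : ∀ j, Commute (CZ j) x) (a b : ℤ) :
    Commute (czProd a b) x := by
  rcases le_total b a with hab | hab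
  · rw [czProd_of_le hab]
    exact Commute.one_left x
  · induction b, hab using Int.leInduction with
    | base => rw [czProd_of_le le_rfl]; exact Commute.one_left x
    | succ b hab ih => rw [czProd_succ hab]; exact ih.mul_left (h b)

theorem czProd_commute (a b c d : ℤ) : Commute (czProd a b) (czProd c d) :=
  czProd_commute_of (fun j => (czProd_commute_of (fun k => CZ_commute k j) c d).symm) a b

theorem star_czProd (a b : ℤ) : star (czProd a b) = czProd a b := by
  rcases le_total b a with hab | hab
  · rw [czProd_of_le hab, star_one]
  · induction b, hab using Int.leInduction with
    | base => rw [czProd_of_le le_rfl, star_one]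
    | succ b hab ih =>
      rw [czProd_succ hab, star_mul, ih, star_CZ,
        (czProd_commute_of (fun j => CZ_commute j b) a b).eq]

theorem czProd_mul_self (a b : ℤ) : czProd a b * czProd a b = 1 := by
  rcases le_total b a with hab | hab
  · rw [czProd_of_le hab, one_mul]
  · induction b, hab using Int.leInduction with
    | base => rw [czProd_of_le le_rfl, one_mul]
    | succ b hab ih =>
      rw [czProd_succ hab, (czProd_commute_of (fun j => CZ_commute j b) a b).symm.mul_mul_mul_comm,
        ih, CZ_mul_self, one_mul]

/-- `U_{[a, b]}` as a unitary. -/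
def czU (a b : ℤ) : unitary Chain :=
  ⟨czProd a b, Unitary.mem_iff.mpr
    ⟨by rw [star_czProd, czProd_mul_self], by rw [star_czProd, czProd_mul_self]⟩⟩

theorem czU_mul_self (a b : ℤ) : czU a b * czU a b = 1 := Subtype.ext (czProd_mul_self a b)

/-- Conjugating an element of `𝒜_{[a, b]}` by `U_{[c, d]}` only involves the gates touching
`[a, b]`. -/
theorem Ad_czU_eq {a b c d : ℤ} {x : Chain} (hab : a ≤ b) (hca : c < a) (hbd : b < d)
    (hx : x ∈ localAlg (Set.Icc a b)) :
    Ad (czU c d) x = Ad (czU (a - 1) (b + 1)) x := by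
  have hu : czU c d = czU (a - 1) (b + 1) * (czU c (a - 1) * czU (b + 1) d) := by
    refine Subtype.ext ?_
    change czProd c d = czProd (a - 1) (b + 1) * (czProd c (a - 1) * czProd (b + 1) d)
    rw [(czProd_commute _ _ _ _).left_comm, czProd_mul_czProd (by omega) (by omega),
      czProd_mul_czProd (by omega) (by omega)]
  have h1 : Commute (czProd c (a - 1)) x :=
    localAlg_commute (Set.disjoint_left.mpr fun i hi hi' => by
      have := hi.2; have := hi'.1; omega) (czProd_mem _ _) hx
  have h2 : Commute (czProd (b + 1) d) x :=
    localAlg_commute (Set.disjoint_left.mpr fun i hi hi' => by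
      have := hi.1; have := hi'.2; omega) (czProd_mem _ _) hx
  rw [hu, Ad_mul, StarAlgEquiv.mul_apply, Ad_eq_self (x := x) (h1.mul_left h2)]

/-- The gates of `U_{[c, e]}` to the right of `d` do not act on operators supported to the left of
`d`. -/
theorem Ad_czU_eq_right {b c d e : ℤ} {x : Chain} (hbd : b < d) (hcd : c ≤ d) (hde : d ≤ e)
    (hx : x ∈ localAlg (Set.Iic b)) : Ad (czU c e) x = Ad (czU c d) x := by
  have hu : czU c e = czU c d * czU d e := Subtype.ext (czProd_mul_czProd hcd hde).symm
  have h1 : Commute (czProd d e) x :=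
    localAlg_commute (Set.disjoint_left.mpr fun i hi hi' => by
      have := hi.1; have := Set.mem_Iic.mp hi'; omega) (czProd_mem _ _) hx
  rw [hu, Ad_mul, StarAlgEquiv.mul_apply, Ad_eq_self (x := x) h1]

/-! ### Limits of inner automorphisms -/

open Filter Topology in
/-- Conjugations by involutive unitaries `uₙ` converge pointwise in norm to an involutive
automorphism once they stabilise on every on-site algebra. -/
theorem exists_limit_aut (u : ℕ → unitary Chain) (hu : ∀ n, u n * u n = 1)
    (hstab : ∀ j, ∃ N, ∀ n ≥ N, ∀ M, Ad (u n) (site j M) = Ad (u N) (site j M)) :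
    ∃ θ : Aut, θ * θ = 1 ∧ ∀ x, Tendsto (fun n => Ad (u n) x) atTop (𝓝 (θ x)) := by
  have hlim : ∀ x : Chain, ∃ y, Tendsto (fun n => Ad (u n) x) atTop (𝓝 y) := by
    let B : StarSubalgebra ℂ Chain :=
      { carrier := {x | ∃ y, Tendsto (fun n => Ad (u n) x) atTop (𝓝 y)}
        mul_mem' := fun {a b} ⟨y, hy⟩ ⟨z, hz⟩ => ⟨y * z, by simpa only [map_mul] using hy.mul hz⟩
        add_mem' := fun {a b} ⟨y, hy⟩ ⟨z, hz⟩ => ⟨y + z, by simpa only [map_add] using hy.add hz⟩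
        algebraMap_mem' := fun c => ⟨algebraMap ℂ Chain c, by
          simpa only [AlgHomClass.commutes] using tendsto_const_nhds⟩
        star_mem' := fun {a} ⟨y, hy⟩ => ⟨star y, by simpa only [map_star] using hy.star⟩ }
    have hBcl : IsClosed (B : Set Chain) := by
      refine isClosed_of_closure_subset fun x hx => ?_
      refine cauchySeq_tendsto_of_complete (Metric.cauchySeq_iff'.mpr fun ε hε => ?_)
      obtain ⟨y, ⟨z, hz⟩, hxy⟩ := Metric.mem_closure_iff.mp hx (ε / 3) (by positivity)
      obtain ⟨N, hN⟩ := Metric.cauchySeq_iff'.mp hz.cauchySeq (ε / 3) (by positivity)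
      refine ⟨N, fun n hn => ?_⟩
      have h1 : ∀ m, dist (Ad (u m) x) (Ad (u m) y) < ε / 3 := fun m => by
        rwa [(StarAlgEquiv.isometry (Ad (u m))).dist_eq]
      have h2 := dist_triangle4 (Ad (u n) x) (Ad (u n) y) (Ad (u N) y) (Ad (u N) x)
      have h3 := hN n hn
      have h4 := h1 N
      rw [dist_comm] at h4
      linarith [h1 n]
    have hgen : localAlg Set.univ ≤ B := localAlg_le hBcl fun j _ M => by
      obtain ⟨N, hN⟩ := hstab j
      exact ⟨_, tendsto_atTop_of_eventually_const fun n hn => hN n hn M⟩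
    exact fun x => hgen (mem_localAlg_univ x)
  choose f hf using hlim
  let F : Chain →⋆ₐ[ℂ] Chain :=
    { toFun := f
      map_one' := tendsto_nhds_unique (hf 1) (by simpa only [map_one] using tendsto_const_nhds)
      map_mul' := fun x y => tendsto_nhds_unique (hf _)
        (by simpa only [map_mul] using (hf x).mul (hf y))
      map_zero' := tendsto_nhds_unique (hf 0) (by simpa only [map_zero] using tendsto_const_nhds)
      map_add' := fun x y => tendsto_nhds_unique (hf _)
        (by simpa only [map_add] using (hf x).add (hf y))
      commutes' := fun c => tendsto_nhds_unique (hf _)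
        (by simpa only [AlgHomClass.commutes] using tendsto_const_nhds)
      map_star' := fun x => tendsto_nhds_unique (hf _)
        (by simpa only [map_star] using (hf x).star) }
  have hinv : ∀ x, f (f x) = x := by
    intro x
    refine tendsto_nhds_unique (hf (f x)) (tendsto_iff_dist_tendsto_zero.mpr ?_)
    have h1 : ∀ n, dist (Ad (u n) (f x)) x = dist (Ad (u n) x) (f x) := fun n => by
      have h2 : Ad (u n) (Ad (u n) x) = x := by
        rw [← StarAlgEquiv.mul_apply, ← Ad_mul, hu]
        exact Ad_eq_self (Commute.one_left x)
      calc dist (Ad (u n) (f x)) x = dist (Ad (u n) (f x)) (Ad (u n) (Ad (u n) x)) := by rw [h2]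
        _ = dist (Ad (u n) x) (f x) := by
          rw [(StarAlgEquiv.isometry (Ad (u n))).dist_eq, dist_comm]
    simp only [h1]
    exact tendsto_iff_dist_tendsto_zero.mp (hf x)
  refine ⟨StarAlgEquiv.ofStarAlgHom F F (StarAlgHom.ext hinv) (StarAlgHom.ext hinv), ?_, hf⟩
  exact StarAlgEquiv.ext hinv

/-! ### The controlled-`Z` symmetry and its right half -/

theorem exists_czAut : ∃ θ : Aut, θ * θ = 1 ∧
    ∀ x, Filter.Tendsto (fun n : ℕ => Ad (czU (-n) n) x) Filter.atTop (nhds (θ x)) := by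
  refine exists_limit_aut (fun n => czU (-n) n) (fun n => czU_mul_self _ _) fun j =>
    ⟨j.natAbs + 1, fun n hn M => ?_⟩
  have hs : site j M ∈ localAlg (Set.Icc j j) := site_mem (by simp) M
  exact (Ad_czU_eq le_rfl (by omega) (by omega) hs).trans
    (Ad_czU_eq le_rfl (by omega) (by omega) hs).symm

/-- Conjugation by the product of the controlled-`Z` gates over the whole chain. -/
def czAut : Aut := exists_czAut.choose

theorem czAut_mul_self : czAut * czAut = 1 := exists_czAut.choose_spec.1

theorem tendsto_czAut (x : Chain) :
    Filter.Tendsto (fun n : ℕ => Ad (czU (-n) n) x) Filter.atTop (nhds (czAut x)) :=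
  exists_czAut.choose_spec.2 x

theorem czAut_eq {a b c d : ℤ} {x : Chain} (hab : a ≤ b) (hca : c < a) (hbd : b < d)
    (hx : x ∈ localAlg (Set.Icc a b)) : czAut x = Ad (czU c d) x := by
  refine tendsto_nhds_unique (tendsto_czAut x) (tendsto_const_nhds.congr' ?_)
  filter_upwards [Filter.eventually_ge_atTop (a.natAbs + b.natAbs + 1)] with n hn
  exact (Ad_czU_eq hab hca hbd hx).trans (Ad_czU_eq hab (by omega) (by omega) hx).symm

theorem isQCA_czAut : IsQCA czAut := by
  refine isQCA_of_site 1 fun j M => ?_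
  rw [czAut_eq (a := j) (b := j) (c := j - 1) (d := j + 1) le_rfl (by omega) (by omega)
    (site_mem (by simp) M)]
  have hsub : Set.Icc (j - 1) (j + 1) ⊆ fatten {j} 1 := fun k hk => by
    rw [mem_fatten_singleton, abs_le]
    have := hk.1
    have := hk.2
    push_cast
    omega
  exact Ad_mem (localAlg_mono hsub (czProd_mem _ _)) (localAlg_mono hsub (site_mem (by simp) M))

theorem exists_czHalf : ∃ θ : Aut, θ * θ = 1 ∧
    ∀ x, Filter.Tendsto (fun n : ℕ => Ad (czU 0 n) x) Filter.atTop (nhds (θ x)) := by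
  refine exists_limit_aut (fun n => czU 0 n) (fun n => czU_mul_self _ _) fun j =>
    ⟨(j + 1).toNat, fun n hn M => ?_⟩
  exact Ad_czU_eq_right (b := j) (by omega) (by omega) (by omega) (site_mem (by simp) M)

/-- Conjugation by the product of the controlled-`Z` gates over the sites `0, 1, 2, …`. -/
def czHalf : Aut := exists_czHalf.choose

theorem czHalf_mul_self : czHalf * czHalf = 1 := exists_czHalf.choose_spec.1

theorem tendsto_czHalf (x : Chain) :
    Filter.Tendsto (fun n : ℕ => Ad (czU 0 n) x) Filter.atTop (nhds (czHalf x)) :=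
  exists_czHalf.choose_spec.2 x

theorem czHalf_eq_czAut {x : Chain} (hx : x ∈ localAlg (Set.Ici 1)) : czHalf x = czAut x := by
  refine Aut.eqOn_localAlg (fun j hj M => ?_) hx
  rw [Set.mem_Ici] at hj
  have hs : site j M ∈ localAlg (Set.Icc j j) := site_mem (by simp) M
  refine tendsto_nhds_unique (tendsto_czHalf _) (tendsto_const_nhds.congr' ?_)
  filter_upwards [Filter.eventually_ge_atTop (j.natAbs + 1)] with n hn
  exact czAut_eq le_rfl (by omega) (by omega) hs

theorem czHalf_eq_self {x : Chain} (hx : x ∈ localAlg (Set.Iio 0)) : czHalf x = x := by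
  refine tendsto_nhds_unique (tendsto_czHalf x) (tendsto_const_nhds.congr fun n => ?_)
  refine (Ad_eq_self (localAlg_commute (Set.disjoint_left.mpr fun i hi hi' => ?_)
    (czProd_mem 0 n) hx)).symm
  have := hi.1
  have := Set.mem_Iio.mp hi'
  omega

/-- The representation of `ℤ₂ = {1, -1}` given by an involutive automorphism. -/
def involutionHom (θ : Aut) (h : θ * θ = 1) : ℤˣ →* Aut where
  toFun g := if g = 1 then 1 else θ
  map_one' := if_pos rfl
  map_mul' g g' := by
    rcases Int.units_eq_one_or g with rfl | rfl <;> rcases Int.units_eq_one_or g' with rfl | rfl <;>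
      simp [h]

theorem involutionHom_neg_one (θ : Aut) (h : θ * θ = 1) : involutionHom θ h (-1) = θ :=
  if_neg (c := (-1 : ℤˣ) = 1) (t := (1 : Aut)) (by decide)

/-- The `ℤ₂`-symmetry generated by the controlled-`Z` automorphism. -/
def czSymmetry : LPSymmetry ℤˣ where
  toHom := involutionHom czAut czAut_mul_self
  isQCA g := by
    rcases Int.units_eq_one_or g with rfl | rfl
    · rw [map_one]; exact IsQCA.one
    · rw [involutionHom_neg_one]; exact isQCA_czAut

theorem czSymmetry_neg_one : czSymmetry.toHom (-1) = czAut :=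
  involutionHom_neg_one czAut czAut_mul_self

theorem isRightRestriction_czHalf :
    IsRightRestriction czSymmetry 0 1 (involutionHom czHalf czHalf_mul_self) := by
  intro g
  rcases Int.units_eq_one_or g with rfl | rfl
  · rw [map_one, map_one]
    exact ⟨fun _ _ => rfl, fun _ _ => rfl⟩
  · rw [involutionHom_neg_one, czSymmetry_neg_one]
    exact ⟨fun x hx => czHalf_eq_czAut (by simpa using hx),
      fun x hx => czHalf_eq_self (localAlg_mono (Set.Iio_subset_Iio (by simp)) hx)⟩

/-! ### The anomaly of a symmetry whose right restriction is a homomorphism -/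

open groupCohomology in
/-- Associator phases which are the coboundary of `l` represent the trivial class. -/
theorem class_eq_zero {G : Type} [Group G] {ω : G → G → G → Circle} (l : G → G → Circle)
    (hl : ∀ f g h, l f g * l (f * g) h = ω f g h * (l g h * l f (g * h)))
    (h : inhomogeneousCochains.d (U1 G) 3
        (fun g => Additive.ofMul (ω (g 0) (g 1) (g 2))) = 0) :
    groupCohomology.π (U1 G) 3 (groupCohomology.cocyclesMk _ h) = 0 := by
  -- the inverse accounts for the sign of `(g₀, g₁)` in the inhomogeneous differential
  let b : (Fin 2 → G) → Additive Circle := fun g => Additive.ofMul (l (g 0) (g 1))⁻¹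
  have hb : inhomogeneousCochains.d (U1 G) 2 b =
      fun g => Additive.ofMul (ω (g 0) (g 1) (g 2)) := by
    funext g
    have h1 : ω (g 0) (g 1) (g 2) = l (g 0) (g 1) * l (g 0 * g 1) (g 2) *
        (l (g 1) (g 2) * l (g 0) (g 1 * g 2))⁻¹ := eq_mul_inv_of_mul_eq (hl _ _ _).symm
    simp [inhomogeneousCochains.d, Fin.sum_univ_three, b, Fin.contractNth]
    rw [h1, ofMul_mul, ofMul_mul, ofMul_inv, ofMul_mul]
    abel
  have hc : cocyclesMk _ h = toCocycles (U1 G) 2 3 b := by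
    apply (ModuleCat.mono_iff_injective (iCocycles (U1 G) 3)).1 inferInstance
    refine (iCocycles_mk _ _).trans (hb.symm.trans ?_)
    refine Eq.trans ?_
      (congrArg (fun f => f.hom b) ((inhomogeneousCochains (U1 G)).toCycles_i 2 3)).symm
    rw [inhomogeneousCochains.d_def]
  rw [hc]
  exact congrArg (fun f => f.hom b) ((inhomogeneousCochains (U1 G)).toCycles_comp_homologyπ 2 3)

section

variable {G : Type} [Group G] {α : LPSymmetry G} {ρ₀ : G →* Aut} {j₀ : ℤ} {L₀ : ℕ}

/-- Two right restrictions of the same symmetry differ by inner automorphisms. -/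
theorem exists_eq_Ad_mul (h₀ : IsRightRestriction α j₀ L₀ ρ₀) {ρ : G → Aut} {j : ℤ} {L : ℕ}
    (h : IsRightRestriction α j L ρ) (g : G) : ∃ v : unitary Chain, ρ g = Ad v * ρ₀ g := by
  obtain ⟨r, hr⟩ := α.isQCA g⁻¹
  set θ : Aut := ρ g * (ρ₀ g)⁻¹ with hθ
  have hθfix : ∀ k, k ∉ Finset.Icc (-(j₀.natAbs + L₀ + (j.natAbs + L) + r : ℤ))
      (j₀.natAbs + L₀ + (j.natAbs + L) + r) → ∀ M, θ (site k M) = site k M := by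
    intro k hk M
    rw [Finset.mem_Icc, not_and_or, not_le, not_le] at hk
    -- `y` is the preimage of the generator under `ρ₀ g`
    suffices H : ∃ y, ρ₀ g y = site k M ∧ ρ g y = site k M by
      obtain ⟨y, h1, h2⟩ := H
      rw [hθ, StarAlgEquiv.mul_apply, ← h1, ← StarAlgEquiv.mul_apply _ _ y, inv_mul_cancel, h1]
      exact h2
    rcases hk with hk | hk
    · exact ⟨site k M, (h₀ g).2 _ (site_mem (Set.mem_Iio.mpr (by omega)) M),
        (h g).2 _ (site_mem (Set.mem_Iio.mpr (by omega)) M)⟩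
    · have hy := hr {k} _ (site_mem (Set.mem_singleton k) M)
      have hα : α.toHom g (α.toHom g⁻¹ (site k M)) = site k M := by
        rw [← StarAlgEquiv.mul_apply, ← map_mul, mul_inv_cancel, map_one]
        rfl
      have hsub : ∀ m : ℤ, m + r ≤ k → fatten {k} r ⊆ Set.Ici m := fun m hm i hi => by
        rw [mem_fatten_singleton, abs_le] at hi
        rw [Set.mem_Ici]
        omega
      refine ⟨α.toHom g⁻¹ (site k M), ?_, ?_⟩
      · rw [(h₀ g).1 _ (localAlg_mono (hsub _ (by omega)) hy), hα]
      · rw [(h g).1 _ (localAlg_mono (hsub _ (by omega)) hy), hα]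
  obtain ⟨v, -, hv⟩ := exists_implementing_unitary (X := Set.univ) (Set.subset_univ _)
    (fun _ _ _ => mem_localAlg_univ _) (fun k _ => hθfix k) (fun k hk => absurd (Set.mem_univ k) hk)
  refine ⟨v, ?_⟩
  have hθv : θ = Ad v := StarAlgEquiv.ext fun x => hv x (mem_localAlg_univ x)
  rw [← hθv, hθ, inv_mul_cancel_right]

/-- If one right restriction `ρ₀` is a homomorphism, the associator phases of every other right
restriction form a coboundary: writing `ρ(g) = Ad(v_g) ρ₀(g)`, the unitaries
`E(g, h) = v_g ρ₀(g)(v_h) v_{gh}*` are associative fusion operators for `ρ`, and all others are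
multiples of them. -/
theorem exists_coboundary (h₀ : IsRightRestriction α j₀ L₀ ρ₀) {ρ : G → Aut} {j : ℤ} {L : ℕ}
    (h : IsRightRestriction α j L ρ) {F : G → G → unitary Chain} (hF : IsFusion ρ F)
    {ω : G → G → G → Circle} (hω : IsAssociator ρ F ω) :
    ∃ l : G → G → Circle, ∀ f g h, l f g * l (f * g) h = ω f g h * (l g h * l f (g * h)) := by
  choose v hv using exists_eq_Ad_mul h₀ h
  let E : G → G → unitary Chain := fun g h => v g * (ρ₀ g).mapU (v h) * (v (g * h))⁻¹
  have hE : ∀ g h, Ad (F g h) = Ad (E g h) := by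
    intro g h
    have h1 : Ad (F g h) = ρ g * ρ h * (ρ (g * h))⁻¹ := by rw [(hF g h).2, mul_inv_cancel_right]
    have h2 : Ad ((v (g * h))⁻¹) = (Ad (v (g * h)))⁻¹ := map_inv _ _
    rw [h1, hv g, hv h, hv (g * h), Ad_mul, Ad_mul, h2, mul_assoc (Ad (v g)),
      ← mul_assoc (ρ₀ g), mul_Ad, map_mul, mul_inv_rev]
    group
  choose l hl using fun g h => exists_circle_of_Ad_eq (hE g h)
  refine ⟨l, fun f g h => ?_⟩
  have hmapU : ∀ (θ : Aut) (u w : unitary Chain), θ.mapU (u * w) = θ.mapU u * θ.mapU w :=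
    fun θ u w => Subtype.ext (map_mul θ _ _)
  have hmapU_inv : ∀ (θ : Aut) (u : unitary Chain), θ.mapU u⁻¹ = (θ.mapU u)⁻¹ :=
    fun θ u => Subtype.ext (map_star θ (u : Chain))
  have hρ : (ρ f).mapU (E g h) = v f * (ρ₀ f).mapU (E g h) * (v f)⁻¹ := by
    refine Subtype.ext ?_
    rw [Aut.coe_mapU, hv f]
    rfl
  have hmapU_mul : (ρ₀ f).mapU ((ρ₀ g).mapU (v h)) = (ρ₀ (f * g)).mapU (v h) := by
    refine Subtype.ext ?_
    rw [map_mul]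
    rfl
  have hassoc : E f g * E (f * g) h = (ρ f).mapU (E g h) * E f (g * h) := by
    rw [hρ]
    simp only [E, hmapU, hmapU_inv, hmapU_mul, mul_assoc f g h]
    group
  have key := hω f g h
  have hassoc' : (E f g : Chain) * E (f * g) h = ρ f (E g h) * E f (g * h) :=
    congrArg Subtype.val hassoc
  rw [hl f g, hl (f * g) h, hl g h, hl f (g * h), map_smul, smul_mul_smul_comm, smul_mul_smul_comm,
    hassoc', smul_smul] at key
  have hne : (ρ f (E g h) * E f (g * h) : Chain) ≠ 0 := by
    rw [← hassoc', ← Submonoid.coe_mul]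
    exact fun h0 => one_ne_zero (α := Chain) (by
      rw [← Unitary.mul_star_self_of_mem (E f g * E (f * g) h).2, h0, zero_mul])
  exact Circle.ext (by simpa using smul_left_injective ℂ hne key)

/-- A symmetry with a right restriction which is a homomorphism has trivial anomaly. -/
theorem hasTrivialAnomaly_of_hom (h₀ : IsRightRestriction α j₀ L₀ ρ₀) : α.HasTrivialAnomaly := by
  intro c
  constructor
  · rintro ⟨j, L, ρ, F, ω, hρ, hF, hω, hd, rfl⟩
    obtain ⟨l, hl⟩ := exists_coboundary h₀ hρ hF hω
    exact class_eq_zero l hl hd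
  · rintro rfl
    have hd : inhomogeneousCochains.d (U1 G) 3
        (fun g => Additive.ofMul ((fun _ _ _ => 1 : G → G → G → Circle) (g 0) (g 1) (g 2))) = 0 :=
      map_zero _
    refine ⟨j₀, L₀, ρ₀, fun _ _ => 1, fun _ _ _ => 1, h₀, fun g h => ⟨⟨∅, one_mem _⟩, ?_⟩,
      fun f g h => ?_, hd, ?_⟩
    · rw [map_mul, show Ad 1 = 1 from map_one _, one_mul]
    · simp
    · exact (class_eq_zero (ω := fun _ _ _ => 1) (fun _ _ => 1) (fun _ _ _ => by simp) hd).symm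

end

/-! ### The tracial state -/

/-- The Pauli matrix `X` at site `j`. -/
def pauliX (j : ℤ) : Chain := site j !![0, 1; 1, 0]

theorem pauliX_mul_self (j : ℤ) : pauliX j * pauliX j = 1 := by
  rw [pauliX, ← map_mul, ← map_one (site j)]
  congr 1
  ext a b
  fin_cases a <;> fin_cases b <;> simp [Matrix.mul_apply]

theorem pauliZ_mul_self (j : ℤ) : pauliZ j * pauliZ j = 1 := by
  rw [pauliZ, ← map_mul, ← map_one (site j)]
  congr 1
  ext a b
  fin_cases a <;> fin_cases b <;> simp [Matrix.mul_apply]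

theorem pauliX_commute (j k : ℤ) : Commute (pauliX j) (pauliX k) := by
  rcases eq_or_ne j k with rfl | h
  · exact Commute.refl _
  · exact site_commute h _ _

theorem star_pauliX (j : ℤ) : star (pauliX j) = pauliX j := by
  rw [pauliX, ← map_star]
  congr 1
  ext a b
  fin_cases a <;> fin_cases b <;> simp [Matrix.star_apply]

theorem pauliZ_mul_pauliX (j : ℤ) : pauliZ j * pauliX j = -(pauliX j * pauliZ j) := by
  rw [pauliX, pauliZ, ← map_mul (site j), ← map_mul (site j), ← map_neg (site j)]
  congr 1
  ext a b
  fin_cases a <;> fin_cases b <;> simp [Matrix.mul_apply]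

theorem norm_pauliX_le (j : ℤ) : ‖pauliX j‖ ≤ 1 := by
  refine (CStarRing.norm_of_mem_unitary (Unitary.mem_iff.mpr ⟨?_, ?_⟩)).le <;>
    rw [star_pauliX, pauliX_mul_self]

/-- Conjugations by Pauli matrices commute up to signs which cancel. -/
theorem pauliZ_pauliX_conj (j k : ℤ) (x : Chain) :
    pauliX k * (pauliZ j * x * pauliZ j) * pauliX k =
      pauliZ j * (pauliX k * x * pauliX k) * pauliZ j := by
  rcases eq_or_ne j k with rfl | h
  · have h1 : pauliX j * pauliZ j = -(pauliZ j * pauliX j) := by rw [pauliZ_mul_pauliX, neg_neg]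
    calc pauliX j * (pauliZ j * x * pauliZ j) * pauliX j
        = pauliX j * pauliZ j * x * (pauliZ j * pauliX j) := by simp only [mul_assoc]
      _ = pauliZ j * pauliX j * x * (pauliX j * pauliZ j) := by
          rw [h1, neg_mul, neg_mul, mul_neg]
      _ = _ := by simp only [mul_assoc]
  · have h1 : Commute (pauliX k) (pauliZ j) := site_commute h.symm _ _
    calc pauliX k * (pauliZ j * x * pauliZ j) * pauliX k
        = pauliX k * pauliZ j * x * (pauliZ j * pauliX k) := by simp only [mul_assoc]
      _ = pauliZ j * pauliX k * x * (pauliX k * pauliZ j) := by rw [h1.eq]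
      _ = _ := by simp only [mul_assoc]

theorem pauliZ_baseVec (j : ℤ) : (pauliZ j).1 baseVec = baseVec := by
  ext σ
  change ∑ b : Fin 2, _ * baseVec (Function.update σ j b) = _
  by_cases h : σ j = 0
  · have hσ : Function.update σ j 0 = σ := by rw [← h]; exact Function.update_eq_self _ _
    simp [h, hσ]
  · have h1 : σ j = 1 := by omega
    have hσ : Function.update σ j 1 = σ := by rw [← h1]; exact Function.update_eq_self _ _
    have h0 : baseVec σ = 0 := by
      classical
      rw [baseVec, lp.single_apply_ne _ _ _ (fun e => h (by rw [e]; rfl))]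
    simp [h1, hσ, h0]

theorem pauliZ_apply_zero (j : ℤ) (f : Hilb) : (pauliZ j).1 f 0 = f 0 := by
  change ∑ b : Fin 2, _ * f (Function.update 0 j b) = _
  have h : Function.update (0 : Config) j 0 = 0 := Function.update_eq_self j (0 : Config)
  simp [h]

/-- Averaging the vector state of the all-up configuration over the spin flips at finitely many
sites. -/
theorem exists_flip_average (s : Finset ℤ) : ∃ t : Chain →ₗ[ℂ] ℂ, t 1 = 1 ∧ (∀ x, ‖t x‖ ≤ ‖x‖) ∧
    (∀ j x, t (pauliZ j * x * pauliZ j) = t x) ∧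
    ∀ j ∈ s, ∀ x, t (pauliX j * x * pauliX j) = t x := by
  induction s using Finset.induction_on with
  | empty =>
    refine ⟨{ toFun := fun x => x.1 baseVec 0, map_add' := fun x y => rfl,
              map_smul' := fun c x => rfl }, ?_, fun x => ?_, fun j x => ?_, by simp⟩
    · classical
      exact lp.single_apply_self (E := fun _ : Config => ℂ) 2 0 1
    · refine (lp.norm_apply_le_norm (by norm_num) _ _).trans ?_
      refine (ContinuousLinearMap.le_opNorm x.1 baseVec).trans ?_
      rw [norm_baseVec, mul_one]
      rfl
    · change (pauliZ j).1 (x.1 ((pauliZ j).1 baseVec)) 0 = x.1 baseVec 0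
      rw [pauliZ_baseVec, pauliZ_apply_zero]
  | insert k s _ ih =>
    obtain ⟨t, h1, hn, hZ, hX⟩ := ih
    let t' : Chain →ₗ[ℂ] ℂ :=
      (1 / 2 : ℂ) • (t + t ∘ₗ LinearMap.mulLeftRight ℂ (pauliX k, pauliX k))
    have ht' : ∀ x, t' x = 1 / 2 * (t x + t (pauliX k * x * pauliX k)) := fun x => rfl
    refine ⟨t', ?_, fun x => ?_, fun j x => ?_, fun j hj x => ?_⟩
    · rw [ht', mul_one, pauliX_mul_self, h1]
      norm_num
    · have h2 : ‖pauliX k * x * pauliX k‖ ≤ ‖x‖ := by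
        calc ‖pauliX k * x * pauliX k‖ ≤ ‖pauliX k‖ * ‖x‖ * ‖pauliX k‖ :=
              (norm_mul_le _ _).trans (by gcongr; exact norm_mul_le _ _)
          _ ≤ 1 * ‖x‖ * 1 := by gcongr <;> exact norm_pauliX_le k
          _ = ‖x‖ := by ring
      rw [ht', norm_mul]
      have h3 := norm_add_le (t x) (t (pauliX k * x * pauliX k))
      have h4 := hn x
      have h5 := (hn _).trans h2
      have h6 : ‖(1 / 2 : ℂ)‖ = 1 / 2 := by norm_num
      rw [h6]
      linarith
    · rw [ht', ht', pauliZ_pauliX_conj, hZ, hZ]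
    · rw [ht', ht']
      rcases Finset.mem_insert.mp hj with rfl | hj
      · have h2 : pauliX j * (pauliX j * x * pauliX j) * pauliX j = x := by
          simp only [mul_assoc, pauliX_mul_self, mul_one]
          rw [← mul_assoc, pauliX_mul_self, one_mul]
        rw [h2, add_comm]
      · have h2 : pauliX k * (pauliX j * x * pauliX j) * pauliX k =
            pauliX j * (pauliX k * x * pauliX k) * pauliX j := by
          calc pauliX k * (pauliX j * x * pauliX j) * pauliX k
              = pauliX k * pauliX j * x * (pauliX j * pauliX k) := by simp only [mul_assoc]
            _ = pauliX j * pauliX k * x * (pauliX k * pauliX j) := by rw [(pauliX_commute j k).eq]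
            _ = _ := by simp only [mul_assoc]
        rw [h2, hX j hj, hX j hj]

/-- Unital contractive tracial functionals on `𝒜`. -/
structure IsTrace (t : Chain →ₗ[ℂ] ℂ) : Prop where
  one : t 1 = 1
  norm_le : ∀ x, ‖t x‖ ≤ ‖x‖
  comm : ∀ x y, t (x * y) = t (y * x)

theorem IsTrace.continuous {t : Chain →ₗ[ℂ] ℂ} (ht : IsTrace t) : Continuous t :=
  AddMonoidHomClass.continuous_of_bound t 1 fun x => by simpa using ht.norm_le x

theorem site_eq_pauli (M : Matrix (Fin 2) (Fin 2) ℂ) (j : ℤ) : site j M =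
    ((M 0 0 + M 1 1) / 2) • 1 + ((M 0 0 - M 1 1) / 2) • pauliZ j +
      ((M 0 1 + M 1 0) / 2) • pauliX j + ((M 0 1 - M 1 0) / 2) • (pauliZ j * pauliX j) := by
  rw [pauliX, pauliZ, ← map_mul (site j), ← map_one (site j), ← map_smul (site j),
    ← map_smul (site j), ← map_smul (site j), ← map_smul (site j), ← map_add (site j),
    ← map_add (site j), ← map_add (site j)]
  congr 1
  ext a b
  fin_cases a <;> fin_cases b <;> simp <;> ring

/-- Invariance under the Pauli conjugations makes a functional tracial, since the Pauli matrices
generate. -/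
theorem isTrace_of_pauli {t : Chain →ₗ[ℂ] ℂ} (h1 : t 1 = 1) (hn : ∀ x, ‖t x‖ ≤ ‖x‖)
    (hZ : ∀ j x, t (pauliZ j * x * pauliZ j) = t x)
    (hX : ∀ j x, t (pauliX j * x * pauliX j) = t x) : IsTrace t := by
  refine ⟨h1, hn, fun x => ?_⟩
  have hcont : Continuous t := AddMonoidHomClass.continuous_of_bound t 1 fun x => by
    simpa using hn x
  -- the tracial elements form a closed `*`-subalgebra
  let T : StarSubalgebra ℂ Chain :=
    { carrier := {x | ∀ y, t (x * y) = t (y * x) ∧ t (star x * y) = t (y * star x)}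
      mul_mem' := fun {a b} ha hb y => by
        constructor
        · rw [mul_assoc, (ha _).1, mul_assoc, (hb _).1, mul_assoc]
        · rw [star_mul, mul_assoc, (hb _).2, mul_assoc, (ha _).2, mul_assoc]
      add_mem' := fun {a b} ha hb y => by
        simp only [star_add, add_mul, mul_add, map_add, (ha y).1, (hb y).1, (ha y).2, (hb y).2,
          and_self]
      algebraMap_mem' := fun c y => by
        rw [← algebraMap_star_comm, Algebra.commutes, Algebra.commutes]
        exact ⟨rfl, rfl⟩
      star_mem' := fun {a} ha y => ⟨(ha y).2, by rw [star_star]; exact (ha y).1⟩ }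
  have hTcl : IsClosed (T : Set Chain) := by
    have : (T : Set Chain) = ⋂ y, ({x | t (x * y) = t (y * x)} ∩
        {x | t (star x * y) = t (y * star x)}) := by
      ext x
      simp only [Set.mem_iInter]
      rfl
    rw [this]
    exact isClosed_iInter fun y => (isClosed_eq (by fun_prop) (by fun_prop)).inter
      (isClosed_eq (by fun_prop) (by fun_prop))
  have key : ∀ p : Chain, p * p = 1 → star p = p → (∀ x, t (p * x * p) = t x) → p ∈ T := by
    intro p hp hs h y
    have h2 : t (p * y) = t (y * p) := by
      rw [← h (y * p), mul_assoc, mul_assoc, hp, mul_one]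
    exact ⟨h2, by rw [hs]; exact h2⟩
  have hZT : ∀ j, pauliZ j ∈ T := fun j => key _ (pauliZ_mul_self j) (by
    rw [pauliZ, ← map_star]
    congr 1
    ext a b
    fin_cases a <;> fin_cases b <;> simp [Matrix.star_apply]) (hZ j)
  have hXT : ∀ j, pauliX j ∈ T := fun j => key _ (pauliX_mul_self j) (star_pauliX j) (hX j)
  have hle : localAlg Set.univ ≤ T := localAlg_le hTcl fun j _ M => by
    rw [site_eq_pauli]
    exact add_mem (add_mem (add_mem (T.smul_mem (one_mem T) _) (T.smul_mem (hZT j) _))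
      (T.smul_mem (hXT j) _)) (T.smul_mem (mul_mem (hZT j) (hXT j)) _)
  exact fun y => (hle (mem_localAlg_univ x) y).1

open Filter Topology in
/-- The flip averages cluster at a functional invariant under all Pauli conjugations. -/
theorem exists_isTrace : ∃ t, IsTrace t := by
  choose τ h1 hn hZ hX using exists_flip_average
  -- an ultrafilter on finite sets of sites which contains the supersets of each of them
  let U : Ultrafilter (Finset ℤ) := Ultrafilter.of atTop
  have hU : (U : Filter (Finset ℤ)) ≤ atTop := Ultrafilter.of_le _
  have hlim : ∀ x, ∃ z ∈ Metric.closedBall (0 : ℂ) ‖x‖, Tendsto (fun s => τ s x) U (𝓝 z) := by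
    intro x
    exact (isCompact_closedBall (0 : ℂ) ‖x‖).ultrafilter_le_nhds (U.map fun s => τ s x)
      (le_principal_iff.mpr (Ultrafilter.mem_map.mpr
        (Filter.univ_mem' fun s => mem_closedBall_zero_iff.mpr (hn s x))))
  choose f hf hft using hlim
  let t : Chain →ₗ[ℂ] ℂ :=
    { toFun := f
      map_add' := fun x y => tendsto_nhds_unique (hft _)
        (by simpa only [map_add] using (hft x).add (hft y))
      map_smul' := fun c x => tendsto_nhds_unique (hft _)
        (by simpa only [map_smul, RingHom.id_apply] using (hft x).const_smul c) }
  refine ⟨t, isTrace_of_pauli ?_ (fun x => mem_closedBall_zero_iff.mp (hf x))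
    (fun j x => ?_) fun j x => ?_⟩
  · exact tendsto_nhds_unique (hft 1) (by simpa only [h1] using tendsto_const_nhds)
  · exact tendsto_nhds_unique (hft _) ((hft x).congr fun s => (hZ s j x).symm)
  · refine tendsto_nhds_unique (hft _) ((hft x).congr' ?_)
    filter_upwards [hU (eventually_ge_atTop {j})] with s hs
    exact (hX s j (Finset.singleton_subset_iff.mp hs) x).symm

theorem IsTrace.comp {t : Chain →ₗ[ℂ] ℂ} (ht : IsTrace t) (θ : Aut) :
    IsTrace (t ∘ₗ ((θ : Chain →⋆ₐ[ℂ] Chain).toAlgHom.toLinearMap)) where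
  one := (congrArg t (map_one θ)).trans ht.one
  norm_le x := (ht.norm_le (θ x)).trans (θ.norm_map x).le
  comm x y := by
    change t (θ (x * y)) = t (θ (y * x))
    rw [_root_.map_mul θ, _root_.map_mul θ, ht.comm]

/-- On a matrix subalgebra whose elements commute with `y`, the functional `t(· y)` is tracial,
hence a multiple of the normalised matrix trace. -/
theorem IsTrace.map_matrix_mul {t : Chain →ₗ[ℂ] ℂ} (ht : IsTrace t) {ι : Type} [Fintype ι]
    [DecidableEq ι] (φ : Matrix ι ι ℂ →⋆ₐ[ℂ] Chain) {y : Chain}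
    (hy : ∀ i j, Commute (mu φ i j) y) (M : Matrix ι ι ℂ) :
    t (φ M * y) = M.trace / Fintype.card ι * t y := by
  obtain ⟨k⟩ := nonempty_index φ
  have hoff : ∀ i j, i ≠ j → t (mu φ i j * y) = 0 := by
    intro i j hij
    rw [← mu_mul_same φ i i j, mul_assoc, ht.comm, mul_assoc, ← (hy i i).eq, ← mul_assoc,
      mu_mul_mu, if_neg hij.symm, zero_mul, map_zero]
  have hdiag : ∀ i, t (mu φ i i * y) = t (mu φ k k * y) := by
    intro i
    rw [← mu_mul_same φ i k i, mul_assoc, ht.comm, mul_assoc, ← (hy i k).eq, ← mul_assoc,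
      mu_mul_same]
  have hcard : (Fintype.card ι : ℂ) * t (mu φ k k * y) = t y := by
    conv_rhs => rw [← one_mul y, ← sum_mu φ, Finset.sum_mul, map_sum]
    simp only [hdiag, Finset.sum_const, Finset.card_univ, nsmul_eq_mul]
  have hne : (Fintype.card ι : ℂ) ≠ 0 := Nat.cast_ne_zero.mpr (Fintype.card_pos_iff.mpr ⟨k⟩).ne'
  rw [eq_sum_mu φ M]
  simp only [Finset.sum_mul, map_sum, smul_mul_assoc, map_smul, smul_eq_mul]
  have h1 : ∀ i, ∑ j, M i j * t (mu φ i j * y) = M i i * t (mu φ k k * y) := by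
    intro i
    rw [Finset.sum_eq_single i (fun j _ hj => by rw [hoff i j hj.symm, mul_zero]) (by simp), hdiag]
  rw [Finset.sum_congr rfl fun i _ => h1 i, ← Finset.sum_mul, ← hcard, Matrix.trace]
  simp only [Matrix.diag_apply]
  field_simp

/-- Traces are multiplicative on disjoint regions. -/
theorem IsTrace.map_mul {t : Chain →ₗ[ℂ] ℂ} (ht : IsTrace t) {X Y : Set ℤ} (hXY : Disjoint X Y)
    {x y : Chain} (hx : x ∈ localAlg X) (hy : y ∈ localAlg Y) : t (x * y) = t x * t y := by
  have := ht.continuous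
  refine localAlg_induction (p := fun x => t (x * y) = t x * t y)
    (isClosed_eq (by fun_prop) (by fun_prop)) (fun S hS x hx => ?_) hx
  obtain ⟨ι, _, _, φ, hφ⟩ := exists_matrixUnits S
  obtain ⟨M, rfl⟩ : x ∈ φ.range := by rw [hφ]; exact hx
  have h1 := ht.map_matrix_mul φ (fun i j => Commute.one_right _) M
  rw [mul_one, ht.one, mul_one] at h1
  have h2 := ht.map_matrix_mul φ (y := y) (fun i j => localAlg_commute (hXY.mono_left hS)
    (by rw [← hφ]; exact ⟨_, rfl⟩) hy) M
  exact h2.trans (by rw [← h1]; rfl)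

/-- The trace is unique, hence invariant under automorphisms. -/
theorem IsTrace.unique {t t' : Chain →ₗ[ℂ] ℂ} (ht : IsTrace t) (ht' : IsTrace t') : t = t' := by
  ext x
  refine localAlg_induction (X := Set.univ) (p := fun x => t x = t' x)
    (isClosed_eq ht.continuous ht'.continuous) (fun S _ x hx => ?_) (mem_localAlg_univ x)
  obtain ⟨ι, _, _, φ, hφ⟩ := exists_matrixUnits S
  obtain ⟨M, rfl⟩ : x ∈ φ.range := by rw [hφ]; exact hx
  have h1 := ht.map_matrix_mul φ (fun i j => Commute.one_right _) M
  have h2 := ht'.map_matrix_mul φ (fun i j => Commute.one_right _) M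
  rw [mul_one, ht.one] at h1
  rw [mul_one, ht'.one] at h2
  exact h1.trans h2.symm

theorem IsTrace.map_aut {t : Chain →ₗ[ℂ] ℂ} (ht : IsTrace t) (θ : Aut) (x : Chain) :
    t (θ x) = t x :=
  LinearMap.congr_fun ((ht.comp θ).unique ht) x

/-! ### Traces of products of controlled-`Z` gates -/

theorem IsTrace.projDown {t : Chain →ₗ[ℂ] ℂ} (ht : IsTrace t) (j : ℤ) :
    t (projDown j) = 1 / 2 := by
  have hZ : t (pauliZ j) = 0 := by
    have h1 : t (pauliZ j) = -t (pauliZ j) := by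
      calc t (pauliZ j) = t (pauliX j * (pauliZ j * pauliX j)) := by
            rw [ht.comm, mul_assoc, pauliX_mul_self, mul_one]
        _ = -t (pauliZ j) := by
            rw [pauliZ_mul_pauliX, mul_neg, map_neg, ← mul_assoc, pauliX_mul_self, one_mul]
    linear_combination h1 / 2
  rw [SpinChain.projDown, map_smul, map_sub, ht.one, hZ]
  norm_num

/-- One step of the transfer matrix: its state is the pair of the traces of `U_{[a, b]}` and of
`U_{[a, b]} P_b`. -/
theorem IsTrace.czProd_succ {t : Chain →ₗ[ℂ] ℂ} (ht : IsTrace t) {a b : ℤ} (h : a ≤ b) :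
    t (czProd a (b + 1)) = t (czProd a b) - t (czProd a b * SpinChain.projDown b) ∧
    t (czProd a (b + 1) * SpinChain.projDown (b + 1)) =
      t (czProd a b) / 2 - t (czProd a b * SpinChain.projDown b) := by
  have hd : Disjoint (Set.Icc a b) {b + 1} := by simp
  have h1 : t (czProd a b * SpinChain.projDown b * SpinChain.projDown (b + 1)) =
      t (czProd a b * SpinChain.projDown b) * (1 / 2) := by
    rw [ht.map_mul hd (mul_mem (czProd_mem a b) (projDown_mem ⟨h, le_rfl⟩)) (projDown_mem rfl),
      ht.projDown]
  have h2 : t (czProd a b * SpinChain.projDown (b + 1)) = t (czProd a b) * (1 / 2) := by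
    rw [ht.map_mul hd (czProd_mem a b) (projDown_mem rfl), ht.projDown]
  have h3 : czProd a (b + 1) = czProd a b -
      (2 : ℂ) • (czProd a b * SpinChain.projDown b * SpinChain.projDown (b + 1)) := by
    rw [SpinChain.czProd_succ h, CZ, mul_sub, mul_one, mul_smul_comm, mul_assoc]
  constructor
  · rw [h3, map_sub, map_smul, h1, smul_eq_mul]
    ring
  · rw [h3, sub_mul, smul_mul_assoc, mul_assoc _ (SpinChain.projDown (b + 1)), projDown_mul_self,
      map_sub, map_smul, h1, h2, smul_eq_mul]
    ring

/-- The normalised trace of the controlled-`Z` chain on `n` sites is `2 ^ (-⌊n / 2⌋)`; the interval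
`[a, b]` has `b - a + 1` sites. -/
theorem IsTrace.czProd_eq {t : Chain →ₗ[ℂ] ℂ} (ht : IsTrace t) (a : ℤ) (k : ℕ) :
    t (czProd a (a + 2 * k)) = (1 / 2) ^ k ∧
    t (czProd a (a + 2 * k + 1)) = (1 / 2) ^ (k + 1) := by
  induction k with
  | zero =>
    have h := (ht.czProd_succ (le_refl a)).1
    rw [czProd_of_le le_rfl, one_mul, ht.one, ht.projDown] at h
    refine ⟨by simp [czProd_of_le, ht.one], ?_⟩
    simp only [Nat.cast_zero, mul_zero, add_zero, h]
    norm_num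
  | succ k ih =>
    have hstep : ∀ b, a ≤ b → t (czProd a (b + 1 + 1)) = t (czProd a b) / 2 := by
      intro b hb
      rw [(ht.czProd_succ (a := a) (b := b + 1) (by omega)).1, (ht.czProd_succ hb).1,
        (ht.czProd_succ hb).2]
      ring
    have e : a + 2 * ((k + 1 : ℕ) : ℤ) = a + 2 * k + 1 + 1 := by push_cast; ring
    rw [e, hstep _ (by omega), hstep _ (by omega), ih.1, ih.2]
    constructor <;> ring

/-! ### The controlled-`Z` symmetry cannot be decoupled -/

/-- Mirror image of `Ad_czU_eq_right`. -/
theorem Ad_czU_eq_left {b c d e : ℤ} {x : Chain} (hdb : d < b) (hcd : c ≤ d) (hde : d ≤ e)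
    (hx : x ∈ localAlg (Set.Ici b)) : Ad (czU c e) x = Ad (czU d e) x := by
  have hu : czU c e = czU d e * czU c d := Subtype.ext (by
    change czProd c e = czProd d e * czProd c d
    rw [(czProd_commute _ _ _ _).eq, czProd_mul_czProd hcd hde])
  have h1 : Commute (czProd c d) x :=
    localAlg_commute (Set.disjoint_left.mpr fun i hi hi' => by
      have := hi.2; have := Set.mem_Ici.mp hi'; omega) (czProd_mem _ _) hx
  rw [hu, Ad_mul, StarAlgEquiv.mul_apply, Ad_eq_self (x := x) h1]

/-- A local unitary whose conjugation preserves both half-chain algebras at a cut is, up to a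
scalar, a product of elements of these two algebras. -/
theorem exists_factorization {w : unitary Chain} {p q c : ℤ}
    (hw : (w : Chain) ∈ localAlg (Set.Icc p q))
    (hleft : ∀ j < c, ∀ M, Ad w (site j M) ∈ localAlg (Set.Iio c))
    (hright : ∀ j ≥ c, ∀ M, Ad w (site j M) ∈ localAlg (Set.Ici c)) :
    ∃ (l : ℂ) (x y : Chain), x ∈ localAlg (Set.Iio c) ∧ y ∈ localAlg (Set.Ici c) ∧
      (w : Chain) = l • (x * y) := by
  have hfix : ∀ j, ¬ (p ≤ j ∧ j ≤ q) → ∀ M, Ad w (site j M) = site j M := fun j hj M =>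
    Ad_eq_self (localAlg_commute (Set.disjoint_singleton_right.mpr hj) hw
      (site_mem (Set.mem_singleton j) M))
  obtain ⟨x, hx, hxw⟩ := exists_implementing_unitary (θ := Ad w) (S := Finset.Icc p (c - 1))
    (X := Set.Iio c) (fun j hj => by
      have := (Finset.mem_Icc.mp (Finset.mem_coe.mp hj)).2
      rw [Set.mem_Iio]
      omega)
    (fun j hj M => hleft j (by rw [Finset.mem_Icc] at hj; omega) M)
    (fun j hj hj' M => hfix j (by
      rw [Finset.mem_Icc] at hj'
      rw [Set.mem_Iio] at hj
      omega) M)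
    (fun j hj M => by
      rw [Set.compl_Iio]
      exact hright j (by simpa using hj) M)
  obtain ⟨y, hy, hyw⟩ := exists_implementing_unitary (θ := Ad w) (S := Finset.Icc c q)
    (X := Set.Ici c) (fun j hj => (Finset.mem_Icc.mp (Finset.mem_coe.mp hj)).1)
    (fun j hj M => hright j (Finset.mem_Icc.mp hj).1 M)
    (fun j hj hj' M => hfix j (by
      rw [Finset.mem_Icc] at hj'
      rw [Set.mem_Ici] at hj
      omega) M)
    (fun j hj M => by
      rw [Set.compl_Ici]
      exact hleft j (by simpa using hj) M)
  have hdisj : Disjoint (Set.Iio c) (Set.Ici c) := Set.Iio_disjoint_Ici le_rfl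
  have hAd : Ad w = Ad (x * y) := by
    refine Aut.ext_site fun j M => ?_
    rw [Ad_mul, StarAlgEquiv.mul_apply]
    rcases lt_or_ge j c with hj | hj
    · have hs : site j M ∈ localAlg (Set.Iio c) := site_mem (Set.mem_Iio.mpr hj) M
      rw [hxw _ hs, Ad_eq_self (u := y) (localAlg_commute hdisj.symm hy hs)]
    · have hs : site j M ∈ localAlg (Set.Ici c) := site_mem (Set.mem_Ici.mpr hj) M
      rw [← hyw _ hs, Ad_eq_self (u := x) (localAlg_commute hdisj hx (hright j hj M))]
  obtain ⟨l, hl⟩ := exists_circle_of_Ad_eq hAd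
  exact ⟨l, x, y, hx, hy, hl⟩

/-- Some cut of the chain does not cut any block of a given partition. -/
theorem BlockPartition.exists_cut (P : BlockPartition) :
    ∃ c : ℤ, ∀ a, (P.block a : Set ℤ) ⊆ Set.Iio c ∨ (P.block a : Set ℤ) ⊆ Set.Ici c := by
  obtain ⟨a₀, ha₀⟩ := P.covers 0
  have hmax := (P.block a₀).max'_mem ⟨0, ha₀⟩
  set m := (P.block a₀).max' ⟨0, ha₀⟩ with hm
  refine ⟨m + 1, fun a => ?_⟩
  by_contra! h
  obtain ⟨⟨y, hy, hyc⟩, x, hx, hxc⟩ := And.imp Set.not_subset.mp Set.not_subset.mp h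
  rw [Set.mem_Iio, not_lt] at hyc
  rw [Set.mem_Ici, not_le] at hxc
  -- an interval reaching across the end `m` of the block `a₀` contains `m`
  have hma : m ∈ P.block a := (P.isInterval a).out hx hy ⟨by omega, by omega⟩
  have haa : a = a₀ := by
    by_contra hne
    exact Finset.disjoint_left.mp (P.disjoint hne) hma hmax
  rw [haa] at hy
  have := (P.block a₀).le_max' y hy
  omega

/-- If a circuit decoupled the symmetry, the traces of `U_{[a, b]}` and of its extensions by one
site at either end would satisfy a product rule which they violate. -/
theorem czSymmetry_not_equivalent (β : LPSymmetry ℤˣ) (hβ : β.IsDecoupled) :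
    ¬ czSymmetry.Equivalent β := by
  rintro ⟨γ, hγ, hconj⟩
  obtain ⟨P, hP⟩ := hβ
  obtain ⟨U, hU⟩ := hP (-1)
  have hconj' : β.toHom (-1) = γ⁻¹ * czAut * γ := by rw [hconj, czSymmetry_neg_one]
  obtain ⟨t, ht⟩ := exists_isTrace
  obtain ⟨c, hc⟩ := P.exists_cut
  obtain ⟨r₁, hr₁⟩ := hγ.isQCA
  obtain ⟨r₂, hr₂⟩ := hγ.inv.isQCA
  set r := max r₁ r₂ with hr
  have hγr : ∀ j M, γ (site j M) ∈ localAlg (Set.Icc (j - r) (j + r)) := fun j M => by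
    refine localAlg_mono ?_ (hr₁ (Set.Icc j j) _ (site_mem (by simp) M))
    exact (fatten_mono_right _ (le_max_left _ _)).trans (fatten_Icc_subset _ _ _)
  have hγi : ∀ X, ∀ x ∈ localAlg X, γ⁻¹ x ∈ localAlg (fatten X r) := fun X x hx =>
    localAlg_mono (fatten_mono_right _ (le_max_right _ _)) (hr₂ X x hx)
  -- a long interval of even length around the cut
  set k : ℕ := 3 * r + 2 with hk
  set a : ℤ := c - k with ha
  set b : ℤ := c + k with hb
  set w : unitary Chain := γ⁻¹.mapU (czU a b) with hw
  have hAdw : Ad w = γ⁻¹ * Ad (czU a b) * γ := by rw [mul_Ad, inv_mul_cancel_right]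
  have hwmem : (w : Chain) ∈ localAlg (Set.Icc (a - r) (b + r)) :=
    localAlg_mono (fatten_Icc_subset _ _ _) (hγi _ _ (czProd_mem a b))
  -- well inside the interval, conjugation by `w` agrees with the decoupled symmetry
  have hmid : ∀ j M, a + r < j → j + r < b → Ad w (site j M) = β.toHom (-1) (site j M) := by
    intro j M h1 h2
    rw [hAdw, hconj']
    simp only [StarAlgEquiv.mul_apply]
    rw [czAut_eq (c := a) (d := b) (by omega) (by omega) (by omega) (hγr j M)]
  have hblock : ∀ i j M, j ∈ P.block i → β.toHom (-1) (site j M) ∈ localAlg (P.block i) := by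
    intro i j M hj
    have hs : site j M ∈ localAlg (P.block i) := site_mem hj M
    rw [(hU i).2 _ hs]
    exact Ad_mem (hU i).1 hs
  have hleft : ∀ j < c, ∀ M, Ad w (site j M) ∈ localAlg (Set.Iio c) := by
    intro j hj M
    rcases lt_or_ge (j + r) (c - r - 1) with hfar | hnear
    · rw [hAdw]
      simp only [StarAlgEquiv.mul_apply]
      rw [Ad_czU_eq_right (b := j + r) hfar (by omega) (by omega)
        (localAlg_mono (fun i hi => hi.2) (hγr j M))]
      have h1 : Ad (czU a (c - r - 1)) (γ (site j M)) ∈ localAlg (Set.Iic (c - r - 1)) :=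
        Ad_mem (localAlg_mono (fun i hi => hi.2) (czProd_mem _ _))
          (localAlg_mono (fun i hi => Set.mem_Iic.mpr (hi.2.trans hfar.le)) (hγr j M))
      refine localAlg_mono ?_ (hγi _ _ h1)
      rintro i ⟨i', hi', hii'⟩
      rw [Set.mem_Iic] at hi'
      rw [abs_le] at hii'
      rw [Set.mem_Iio]
      omega
    · rw [hmid j M (by omega) (by omega)]
      obtain ⟨i, hi⟩ := P.covers j
      refine localAlg_mono ((hc i).resolve_right fun h => ?_) (hblock i j M hi)
      have := Set.mem_Ici.mp (h (Finset.mem_coe.mpr hi))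
      omega
  have hright : ∀ j ≥ c, ∀ M, Ad w (site j M) ∈ localAlg (Set.Ici c) := by
    intro j hj M
    rcases lt_or_ge (c + r) (j - r) with hfar | hnear
    · rw [hAdw]
      simp only [StarAlgEquiv.mul_apply]
      rw [Ad_czU_eq_left (b := j - r) hfar (by omega) (by omega)
        (localAlg_mono (fun i hi => hi.1) (hγr j M))]
      have h1 : Ad (czU (c + r) b) (γ (site j M)) ∈ localAlg (Set.Ici (c + r)) :=
        Ad_mem (localAlg_mono (fun i hi => hi.1) (czProd_mem _ _))
          (localAlg_mono (fun i hi => Set.mem_Ici.mpr (hfar.le.trans hi.1)) (hγr j M))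
      refine localAlg_mono ?_ (hγi _ _ h1)
      rintro i ⟨i', hi', hii'⟩
      rw [Set.mem_Ici] at hi'
      rw [abs_le] at hii'
      rw [Set.mem_Ici]
      omega
    · rw [hmid j M (by omega) (by omega)]
      obtain ⟨i, hi⟩ := P.covers j
      refine localAlg_mono ((hc i).resolve_left fun h => ?_) (hblock i j M hi)
      have := Set.mem_Iio.mp (h (Finset.mem_coe.mpr hi))
      omega
  obtain ⟨l, x, y, hx, hy, hwxy⟩ := exists_factorization hwmem hleft hright
  -- the two gates which extend the interval by one site at either end
  have hu : γ⁻¹ (CZ (a - 1)) ∈ localAlg (Set.Iio c) := by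
    have h1 : CZ (a - 1) ∈ localAlg (Set.Icc (a - 1) a) :=
      CZ_mem ⟨le_rfl, by omega⟩ ⟨by omega, by omega⟩
    refine localAlg_mono (fun i hi => ?_) (hγi _ _ h1)
    have := (fatten_Icc_subset _ _ _ hi).2
    rw [Set.mem_Iio]
    omega
  have hv : γ⁻¹ (CZ b) ∈ localAlg (Set.Ici c) := by
    have h1 : CZ b ∈ localAlg (Set.Icc b (b + 1)) :=
      CZ_mem ⟨le_rfl, by omega⟩ ⟨by omega, le_rfl⟩
    refine localAlg_mono (fun i hi => ?_) (hγi _ _ h1)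
    have := (fatten_Icc_subset _ _ _ hi).1
    rw [Set.mem_Ici]
    omega
  have hd : Disjoint (Set.Iio c) (Set.Ici c) := Set.Iio_disjoint_Ici le_rfl
  have hw' : γ⁻¹ (czProd a b) = l • (x * y) := hwxy
  have t00 : t (czProd a b) = l * (t x * t y) := by
    rw [← ht.map_aut γ⁻¹, hw', map_smul, ht.map_mul hd hx hy, smul_eq_mul]
  have t10 : t (CZ (a - 1) * czProd a b) = l * (t (γ⁻¹ (CZ (a - 1)) * x) * t y) := by
    rw [← ht.map_aut γ⁻¹, map_mul, hw', mul_smul_comm, map_smul, ← mul_assoc,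
      ht.map_mul hd (mul_mem hu hx) hy, smul_eq_mul]
  have t01 : t (czProd a b * CZ b) = l * (t x * t (y * γ⁻¹ (CZ b))) := by
    rw [← ht.map_aut γ⁻¹, map_mul, hw', smul_mul_assoc, map_smul, mul_assoc,
      ht.map_mul hd hx (mul_mem hy hv), smul_eq_mul]
  have t11 : t (CZ (a - 1) * czProd a b * CZ b) =
      l * (t (γ⁻¹ (CZ (a - 1)) * x) * t (y * γ⁻¹ (CZ b))) := by
    rw [← ht.map_aut γ⁻¹, map_mul γ⁻¹, map_mul γ⁻¹, hw', mul_smul_comm, smul_mul_assoc, map_smul,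
      ← mul_assoc, mul_assoc _ y, ht.map_mul hd (mul_mem hu hx) (mul_mem hy hv), smul_eq_mul]
  have hsq : t (czProd a b) * t (CZ (a - 1) * czProd a b * CZ b) =
      t (CZ (a - 1) * czProd a b) * t (czProd a b * CZ b) := by
    rw [t00, t10, t01, t11]
    ring
  -- the actual traces violate this identity
  have hsucc : czProd a b * CZ b = czProd a (b + 1) := (czProd_succ (by omega)).symm
  have hpred : CZ (a - 1) * czProd a b = czProd (a - 1) b := by
    have := czProd_mul_czProd (a := a - 1) (b := a - 1 + 1) (c := b) (by omega) (by omega)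
    rwa [czProd_single, sub_add_cancel] at this
  have hboth : czProd (a - 1) b * CZ b = czProd (a - 1) (b + 1) := (czProd_succ (by omega)).symm
  have e0 : b = a + 2 * k := by omega
  have e1 : b + 1 = a + 2 * k + 1 := by omega
  have e2 : b = a - 1 + 2 * k + 1 := by omega
  have e3 : b + 1 = a - 1 + 2 * ((k + 1 : ℕ) : ℤ) := by push_cast; omega
  have v00 : t (czProd a b) = (1 / 2) ^ k := by rw [e0]; exact (ht.czProd_eq a k).1
  have v01 : t (czProd a (b + 1)) = (1 / 2) ^ (k + 1) := by rw [e1]; exact (ht.czProd_eq a k).2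
  have v10 : t (czProd (a - 1) b) = (1 / 2) ^ (k + 1) := by
    rw [e2]; exact (ht.czProd_eq (a - 1) k).2
  have v11 : t (czProd (a - 1) (b + 1)) = (1 / 2) ^ (k + 1) := by
    rw [e3]; exact (ht.czProd_eq (a - 1) (k + 1)).1
  rw [hsucc, hpred, hboth, v00, v01, v10, v11, pow_succ] at hsq
  have hne : ((1 / 2 : ℂ) ^ k) ≠ 0 := pow_ne_zero _ (by norm_num)
  refine mul_ne_zero hne hne ?_
  linear_combination 4 * hsq

end SpinChain
end

theorem mainTheorem8 :
    ∃ α : SpinChain.LPSymmetry ℤˣ,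
      (∀ x : SpinChain.Chain,
        Filter.Tendsto
          (fun n : ℕ => SpinChain.czProd (-n) n * x * star (SpinChain.czProd (-n) n))
          Filter.atTop (nhds (α.toHom (-1) x))) ∧
      α.HasTrivialAnomaly ∧
      ∀ β : SpinChain.LPSymmetry ℤˣ, β.IsDecoupled → ¬ α.Equivalent β := by
  refine ⟨SpinChain.czSymmetry, fun x => ?_,
    SpinChain.hasTrivialAnomaly_of_hom SpinChain.isRightRestriction_czHalf,
    SpinChain.czSymmetry_not_equivalent⟩
  rw [SpinChain.czSymmetry_neg_one]
  exact SpinChain.tendsto_czAut x
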